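/- Let $G=(V,E)$ be a finite connected plane graph (loops and parallel edges allowed), described combinatorially by its rotation system of genus $0$, i.e. by the cyclic order of the edge-ends around every vertex. Its dual $G^*$ is the multigraph whose vertices are the faces of $G$ and which has, for each $e\in E$, one edge $e^*$ joining the two (possibly equal) faces on the sides of $e$. Let $D(J)=\{e^*: e\in J\}$ be the natural bijection $2^{E(G)}\to 2^{E(G^*)}$. For $k\in\mathbb N$ let $\mathscr P_k(G)$ be the set of unordered partitions of $V$ into $k$ blocks, each inducing a connected (nonempty) subgraph. For a partition $P$ let $\mathrm{cut}(P)$ be the set of edges of $G$ with endpoints in different blocks of $P$, and for $J\subseteq E$ let $\mathrm{comp}(J)$ be the partition of $V$ into the connected components of $G\setminus J$. For a finite multigraph $H$ and $J\subseteq E(H)$, let $H[J]$ be the subgraph formed by the edges in $J$ and their endpoints, and let the circuit rank $h_1(H[J])$ be the least number of edges whose removal turns $H[J]$ into a forest. The set $\mathscr P_k^*(H)$ of dual $k$-partitions of $H$ consists of the $J\subseteq E(H)$ such that every connected component of $H[J]$ is $2$-edge-connected (connected, and still connected after the deletion of any one edge) and $h_1(H[J])=k-1$. Then: 1. For every $k$,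 the map $D\circ\mathrm{cut}$ is a bijection from $\mathscr P_k(G)$ to $\mathscr P_k^*(G^*)$, and its inverse is the bijection $\mathrm{comp}\circ D^{-1}:\mathscr P_k^*(G^*)\to\mathscr P_k(G)$. 2. A set $J\subseteq E(G^*)$ is a dual $k$-partition of $G^*$ if and only if it is a union of (not necessarily disjoint) simple cycles of $G^*$ and $h_1(G^*[J])=k-1$. (A loop is a cycle of length $1$, and two parallel edges form a cycle of length $2$.) 3. Both maps are computable in polynomial time: there are a deterministic polynomial-time Turing machine that, given a connected plane graph $G$ (as a rotation system) and a partition $P\in\mathscr P_k(G)$ for some $k$, outputs $D(\mathrm{cut}(P))$, and a deterministic polynomial-time Turing machine that, given $G$ and some $J\in\mathscr P_k^*(G^*)$ for some $k$, outputs $\mathrm{comp}(D^{-1}(J))$. The polynomial time bounds depend only on the length of the input, uniformly in $k$. Here a set of edges of $G^*$ is encoded by its characteristic bit vector, indexed by the edges $e$ of $G$ through $e\leftrightarrow e^*$. -/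

import Mathlib

/-! Finite multigraphs are Mathlib's `Graph α β` (vertices of type `α`, edges of type `β`, loops and
parallel edges allowed). -/

namespace PlaneDuality

section Graphs

variable {α β : Type*}

/-- `v` can be reached from `u` by walking along edges of `G`. -/
def Reachable (G : Graph α β) (u v : α) : Prop :=
  Relation.ReflTransGen G.Adj u v

/-- Connected graphs (the graph without vertices is not connected). -/
def IsConn (G : Graph α β) : Prop :=
  G.vertexSet.Nonempty ∧ ∀ u ∈ G.vertexSet, ∀ v ∈ G.vertexSet, Reachable G u v

/-- The vertex sets of the connected components of `G`. -/
def componentSets (G : Graph α β) : Set (Set α) :=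
  {C | ∃ u ∈ G.vertexSet, C = {v | Reachable G u v}}

/-- `G` is connected and remains connected after the deletion of any single edge. -/
def IsTwoEdgeConn (G : Graph α β) : Prop :=
  IsConn G ∧ ∀ e ∈ G.edgeSet, IsConn (G.deleteEdges {e})

/-- The subgraph `G[J]` induced by a set `J` of edges: the edges in `J` and their ends. -/
def edgeInduce (G : Graph α β) (J : Set β) : Graph α β :=
  (G.restrict J).induce {v | ∃ e ∈ J, G.Inc e v}

/-- `C` is the edge set of a simple cycle of `G`: there are distinct vertices `v₀, …, vₙ` and
distinct edges `e₀, …, eₙ`, where `eᵢ` joins `vᵢ` to `vᵢ₊₁` (indices modulo `n + 1`). A loop is a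
cycle of length one, two parallel edges form a cycle of length two. -/
def IsCycleSet (G : Graph α β) (C : Set β) : Prop :=
  ∃ (n : ℕ) (v : Fin (n + 1) → α) (e : Fin (n + 1) → β),
    Function.Injective v ∧ Function.Injective e ∧
    (∀ i, G.IsLink (e i) (v i) (v (i + 1))) ∧ C = Set.range e

/-- `J` is a union of not necessarily disjoint simple cycles of `G`. -/
def IsUnionOfCycles (G : Graph α β) (J : Set β) : Prop :=
  ∃ 𝒞 : Set (Set β), (∀ C ∈ 𝒞, IsCycleSet G C) ∧ J = ⋃₀ 𝒞

/-- `G` has no cycles. -/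
def IsForest (G : Graph α β) : Prop :=
  ∀ C, ¬ IsCycleSet G C

/-- The circuit rank `h₁(G)`: the least number of edges whose removal makes `G` a forest. -/
noncomputable def circuitRank (G : Graph α β) : ℕ :=
  sInf {r | ∃ S ⊆ G.edgeSet, S.Finite ∧ S.ncard = r ∧ IsForest (G.deleteEdges S)}

/-- The unordered connected `k`-partitions of `G`: sets of `k` pairwise disjoint vertex sets that
cover the vertices of `G`, each of which induces a connected (hence nonempty) subgraph. -/
def connectedPartitions (G : Graph α β) (k : ℕ) : Set (Set (Set α)) :=
  {P | P.encard = k ∧ P.PairwiseDisjoint id ∧ ⋃₀ P = G.vertexSet ∧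
    ∀ A ∈ P, IsConn (G.induce A)}

/-- The edges of `G` with ends in different blocks of `P`. -/
def cut (G : Graph α β) (P : Set (Set α)) : Set β :=
  {e | ∃ A ∈ P, ∃ B ∈ P, A ≠ B ∧ ∃ u ∈ A, ∃ v ∈ B, G.IsLink e u v}

/-- The partition of the vertices into the connected components of `G ∖ J`. -/
def comp (G : Graph α β) (J : Set β) : Set (Set α) :=
  componentSets (G.deleteEdges J)

/-- The sets `J` of edges of `G` such that each component of `G[J]` is 2-edge-connected. -/
def dualConnectedPartitions (G : Graph α β) : Set (Set β) :=
  {J | J ⊆ G.edgeSet ∧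
    ∀ C ∈ componentSets (edgeInduce G J), IsTwoEdgeConn ((edgeInduce G J).induce C)}

/-- The dual `k`-partitions of `G`: moreover `h₁(G[J]) = k - 1`. -/
def dualPartitions (G : Graph α β) (k : ℕ) : Set (Set β) :=
  {J | J ∈ dualConnectedPartitions G ∧ circuitRank (edgeInduce G J) + 1 = k}

end Graphs

section PlaneGraphs

/-- A graph embedded in a closed oriented surface, given by its rotation system. Each edge `e` has
two darts (orientations) `(e, false)` and `(e, true)`; `tail d` is the vertex at which the dart `d`
starts, and `next d` is the dart that follows `d` in the cyclic order around that vertex, so that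
the darts starting at a vertex form exactly one cycle of the permutation `next`. -/
structure RotationSystem (V E : Type*) where
  tail : E × Bool → V
  next : Equiv.Perm (E × Bool)
  sameCycle_iff : ∀ d d', next.SameCycle d d' ↔ tail d = tail d'

/-- The edge `e*` of the dual graph that crosses the edge `e`. -/
@[ext]
structure DualEdge (E : Type*) where
  primal : E

/-- The natural bijection from sets of edges of `G` to sets of edges of `G*`. -/
def dualEdges (E : Type*) : Set E ≃ Set (DualEdge E) where
  toFun J := {f | f.primal ∈ J}
  invFun K := {e | DualEdge.mk e ∈ K}
  left_inv _ := rfl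
  right_inv _ := rfl

namespace RotationSystem

variable {V E : Type*} (M : RotationSystem V E)

/-- The underlying graph. -/
def graph : Graph V E where
  vertexSet := Set.univ
  IsLink e x y := ∃ b, M.tail (e, b) = x ∧ M.tail (e, !b) = y
  edgeSet := Set.univ
  isLink_symm := by
    rintro e -
    exact ⟨fun x y ⟨b, hx, hy⟩ => ⟨!b, hy, by simpa using hx⟩⟩
  eq_or_eq_of_isLink_of_isLink := by
    rintro e x y v w ⟨b, rfl, rfl⟩ ⟨c, rfl, rfl⟩
    cases b <;> cases c <;> simp
  edge_mem_iff_exists_isLink e := by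
    simp only [Set.mem_univ, true_iff]
    exact ⟨_, _, false, rfl, rfl⟩
  left_mem_of_isLink := by
    intros
    exact Set.mem_univ _

/-- The dart with the opposite orientation. -/
def rev (E : Type*) : Equiv.Perm (E × Bool) where
  toFun d := (d.1, !d.2)
  invFun d := (d.1, !d.2)
  left_inv d := by simp
  right_inv d := by simp

/-- One step of the walk around a face: traverse `d`, then turn to the next dart at its head. -/
def faceNext : Equiv.Perm (E × Bool) :=
  (rev E).trans M.next

/-- The faces of a connected embedded graph: the orbits of the face walk; a graph without edges (a
single vertex) has one face, which is not bounded by any dart. -/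
def Face : Type _ :=
  Quotient (Equiv.Perm.SameCycle.setoid M.faceNext) ⊕ PLift (IsEmpty E)

/-- The face lying along the dart `d`. -/
def faceOf (d : E × Bool) : M.Face :=
  Sum.inl (Quotient.mk _ d)

/-- The dual graph `G*`: its vertices are the faces of `G`, and `e*` joins the two faces (possibly
equal) on the two sides of `e`. -/
def dual : Graph M.Face (DualEdge E) where
  vertexSet := Set.univ
  IsLink f x y := ∃ b, M.faceOf (f.primal, b) = x ∧ M.faceOf (f.primal, !b) = y
  edgeSet := Set.univ
  isLink_symm := by
    rintro e -
    exact ⟨fun x y ⟨b, hx, hy⟩ => ⟨!b, hy, by simpa using hx⟩⟩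
  eq_or_eq_of_isLink_of_isLink := by
    rintro e x y v w ⟨b, rfl, rfl⟩ ⟨c, rfl, rfl⟩
    cases b <;> cases c <;> simp
  edge_mem_iff_exists_isLink e := by
    simp only [Set.mem_univ, true_iff]
    exact ⟨_, _, false, rfl, rfl⟩
  left_mem_of_isLink := by
    intros
    exact Set.mem_univ _

/-- The Euler characteristic of the surface obtained by gluing a disc into each face. -/
noncomputable def eulerChar : ℤ :=
  Nat.card V - Nat.card E + Nat.card M.Face

/-- Connected plane graphs: the graph is connected, and the surface in which it is embedded is the
sphere, that is, has genus `0`. -/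
def IsConnectedPlane : Prop :=
  IsConn M.graph ∧ 2 - M.eulerChar = 0

/-- The map `D ∘ cut`. -/
def dualCut (P : Set (Set V)) : Set (DualEdge E) :=
  dualEdges E (cut M.graph P)

/-- The map `comp ∘ D⁻¹`. -/
def compDual (J : Set (DualEdge E)) : Set (Set V) :=
  comp M.graph ((dualEdges E).symm J)

end RotationSystem

end PlaneGraphs

/-! Encodings by bit strings. Numbers are written in unary; as a plane graph is described by a list
of vertices and edges, this changes the length of its description only polynomially. -/

section Encoding

/-- The number `i` in unary, with an end marker. -/
def unary (i : ℕ) : List Bool :=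
  List.replicate i true ++ [false]

/-- A plane graph: the numbers of vertices and of edges, and for each dart its tail and the dart
that follows it in the rotation (the dart `(e, b)` has the number `2 * e + b`). -/
def encodePlaneGraph {n m : ℕ} (M : RotationSystem (Fin n) (Fin m)) : List Bool :=
  unary n ++ unary m ++
    (List.finRange m).flatMap fun e =>
      [false, true].flatMap fun b =>
        unary (M.tail (e, b)) ++
          unary (2 * ((M.next (e, b)).1 : ℕ) + (M.next (e, b)).2.toNat)

open scoped Classical in
/-- A set of vertices as a characteristic bit vector. -/
noncomputable def encodeVertexSet {n : ℕ} (A : Set (Fin n)) : List Bool :=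
  (List.finRange n).map fun v => decide (v ∈ A)

/-- A partition of the vertices: for each vertex in turn, the block that contains it. -/
noncomputable def encodePartition {n : ℕ} (P : Set (Set (Fin n))) : List Bool :=
  (List.finRange n).flatMap fun v => encodeVertexSet {w | ∃ A ∈ P, v ∈ A ∧ w ∈ A}

open scoped Classical in
/-- A set of edges of the dual graph as a characteristic bit vector. -/
noncomputable def encodeDualEdgeSet {m : ℕ} (J : Set (DualEdge (Fin m))) : List Bool :=
  (List.finRange m).map fun e => decide (DualEdge.mk e ∈ J)

/-- The inputs of `D ∘ cut`: a connected plane graph and a connected `k`-partition of it. -/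
structure PartitionInstance where
  n : ℕ
  m : ℕ
  k : ℕ
  M : RotationSystem (Fin n) (Fin m)
  isConnectedPlane : M.IsConnectedPlane
  P : Set (Set (Fin n))
  mem : P ∈ connectedPartitions M.graph k

/-- The inputs of `comp ∘ D⁻¹`: a connected plane graph and a dual `k`-partition of its dual. -/
structure DualPartitionInstance where
  n : ℕ
  m : ℕ
  k : ℕ
  M : RotationSystem (Fin n) (Fin m)
  isConnectedPlane : M.IsConnectedPlane
  J : Set (DualEdge (Fin m))
  mem : J ∈ dualPartitions M.dual k

noncomputable def PartitionInstance.encode (I : PartitionInstance) : List Bool :=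
  encodePlaneGraph I.M ++ encodePartition I.P

noncomputable def DualPartitionInstance.encode (I : DualPartitionInstance) : List Bool :=
  encodePlaneGraph I.M ++ encodeDualEdgeSet I.J

/-- `D ∘ cut` as a function of the plane graph and the partition. -/
def PartitionInstance.dualCut (I : PartitionInstance) : Σ m : ℕ, Set (DualEdge (Fin m)) :=
  ⟨I.m, I.M.dualCut I.P⟩

/-- `comp ∘ D⁻¹` as a function of the plane graph and the set of edges of its dual. -/
def DualPartitionInstance.compDual (I : DualPartitionInstance) : Σ n : ℕ, Set (Set (Fin n)) :=
  ⟨I.n, I.M.compDual I.J⟩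

end Encoding

end PlaneDuality

/-! Connected partitions of a plane graph and their dual partitions. -/

namespace PlaneDuality

open Graph

/-! ### Reachability in subgraphs given by edge sets, and the effect of one extra edge. -/

section Reachability

variable {α β : Type*} {G H : Graph α β} {A B J : Set β} {e : β} {u v x y z : α}

/-! Everything about circuit rank and cycles is expressed through the nullity |A| + c(A) - |V| of a
set A of edges, where c(A) counts the components of the spanning subgraph (V, A). Adding an edge
raises the nullity by 1 if its ends are already joined and leaves it unchanged otherwise. Hence the
circuit rank of H[J] is the nullity of J (`circuitRank_edgeInduce`). Both "every component of H[J]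
is 2-edge-connected" and "J is a union of cycles" say that J has no bridges
(`mem_dualConnectedPartitions_iff`, `isUnionOfCycles_iff_isBridgeless`); this gives the second
claim.

Duality rests on the quantity f(A) = |A| + c(A) - c*(complement of A), with c* counting components
in the dual. Adding an edge e to A changes f by 1, minus 1 if e merges two components of (V, A),
minus 1 if removing e* separates two dual components. The last two cannot both happen
(`reachable_of_not_dual_reachable`): the indicators of a primal and of a dual component would
violate the orthogonality of vertex and face coboundaries. So f is monotone, in any genus. Its
values at the empty set and at E are |V| - 1 and |E| + 1 - |F|, which agree exactly when Euler's
formula holds, so on the sphere f is constant. This is `nullity_dual`: the nullity of J* plus 1 is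
the number of components of G ∖ J. Comparing J with J ∖ {e} shows that e* is not a bridge of J*
exactly when the ends of e lie in different components of G ∖ J (`reachable_dual_iff`). The dual
k-partitions are therefore the sets J for which G ∖ J has k components and every edge of J runs
between two of them, and on these sets `cut` and `comp` are visibly inverse to each other.

For the complexity claim, structured programs on stacks of bits are compiled to Mathlib's `TM2`
machines. The program for `D ∘ cut` looks up, for every edge, one entry of the matrix that encodes
the partition. The program for `comp ∘ D⁻¹` computes each row of the reachability matrix by n
relaxation passes over the edges outside J; a pass that does not stabilise the row adds an entry, so
n passes suffice. Since numbers are written in unary, they are bounded by the input length, and so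
all loops are polynomial. -/

theorem Reachable.refl (G : Graph α β) (x : α) : Reachable G x x := Relation.ReflTransGen.refl

theorem Reachable.symm (h : Reachable G x y) : Reachable G y x := by
  induction h with
  | refl => exact .refl _ _
  | tail _ h ih => exact Relation.ReflTransGen.head h.symm ih

theorem Reachable.trans (h : Reachable G x y) (h' : Reachable G y z) : Reachable G x z :=
  Relation.ReflTransGen.trans h h'

theorem Reachable.of_isLink (h : G.IsLink e x y) : Reachable G x y :=
  Relation.ReflTransGen.single ⟨e, h⟩

theorem Reachable.mono (hGH : ∀ e x y, G.IsLink e x y → Reachable H x y)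
    (h : Reachable G x y) : Reachable H x y := by
  induction h with
  | refl => exact .refl _ _
  | tail _ h ih =>
    obtain ⟨e, he⟩ := h
    exact ih.trans (hGH _ _ _ he)

theorem Reachable.restrict_mono (hAB : A ⊆ B) (h : Reachable (G.restrict A) x y) :
    Reachable (G.restrict B) x y :=
  h.mono fun e _ _ (h : _ ∧ _) => .of_isLink (e := e) ⟨hAB h.1, h.2⟩

theorem Reachable.restrict_subset_of_reachable
    (h : Reachable (G.restrict (insert e A)) x y) (he : G.IsLink e u v)
    (huv : Reachable (G.restrict A) u v) : Reachable (G.restrict A) x y := by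
  refine h.mono fun f a b hf => ?_
  obtain ⟨rfl | hfA, hl⟩ := hf
  · obtain ⟨rfl, rfl⟩ | ⟨rfl, rfl⟩ := hl.eq_and_eq_or_eq_and_eq he
    exacts [huv, huv.symm]
  · exact .of_isLink (e := f) ⟨hfA, hl⟩

/-- A walk may cross `e` many times, but one crossing, in one of the two directions, is enough; the
three alternatives are stable under appending a step. -/
theorem reachable_restrict_insert (he : G.IsLink e u v)
    (h : Reachable (G.restrict (insert e A)) x y) :
    Reachable (G.restrict A) x y ∨
      (Reachable (G.restrict A) x u ∧ Reachable (G.restrict A) v y) ∨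
      (Reachable (G.restrict A) x v ∧ Reachable (G.restrict A) u y) := by
  induction h with
  | refl => exact .inl (.refl _ _)
  | @tail b c _ h ih =>
    obtain ⟨f, hf, hl⟩ := h
    obtain rfl | hfA := hf
    · obtain ⟨rfl, rfl⟩ | ⟨rfl, rfl⟩ := hl.eq_and_eq_or_eq_and_eq he
      · obtain h | ⟨h, h'⟩ | ⟨h, h'⟩ := ih
        · exact .inr (.inl ⟨h, .refl _ _⟩)
        · exact .inr (.inl ⟨h, .refl _ _⟩)
        · exact .inl h
      · obtain h | ⟨h, h'⟩ | ⟨h, h'⟩ := ih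
        · exact .inr (.inr ⟨h, .refl _ _⟩)
        · exact .inl h
        · exact .inr (.inr ⟨h, .refl _ _⟩)
    · have hbc : Reachable (G.restrict A) b c := .of_isLink (e := f) ⟨hfA, hl⟩
      obtain h | ⟨h, h'⟩ | ⟨h, h'⟩ := ih
      · exact .inl (h.trans hbc)
      · exact .inr (.inl ⟨h, h'.trans hbc⟩)
      · exact .inr (.inr ⟨h, h'.trans hbc⟩)

theorem setOf_reachable_eq_iff :
    {z | Reachable G x z} = {z | Reachable G y z} ↔ Reachable G x y := by
  refine ⟨fun h => ?_, fun h => ?_⟩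
  · have : y ∈ {z | Reachable G y z} := .refl _ _
    rwa [← h] at this
  · ext z
    exact ⟨fun h' => h.symm.trans h', fun h' => h.trans h'⟩

theorem Reachable.mem_vertexSet (h : Reachable G x y) (hx : x ∈ G.vertexSet) :
    y ∈ G.vertexSet := by
  induction h with
  | refl => exact hx
  | tail _ h _ => exact h.right_mem

end Reachability

/-! ### Component counts, nullity and acyclic edge sets. -/

section Nullity

variable {α β : Type*} {G : Graph α β} {A B J : Set β} {e : β} {u v x y z : α}

/-- The number of connected components of the spanning subgraph with edge set `A`. -/
noncomputable def numComponents (G : Graph α β) (A : Set β) : ℕ :=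
  (componentSets (G.restrict A)).ncard

theorem componentSets_eq_image (G : Graph α β) :
    componentSets G = (fun u => {v | Reachable G u v}) '' G.vertexSet := by
  ext C
  simp only [componentSets, Set.mem_ofPred_eq, Set.mem_image, eq_comm]

theorem componentSets_finite (hV : G.vertexSet.Finite) : (componentSets G).Finite := by
  rw [componentSets_eq_image]
  exact hV.image _

theorem numComponents_empty (G : Graph α β) : numComponents G ∅ = G.vertexSet.ncard := by
  rw [numComponents, componentSets_eq_image]
  refine Set.InjOn.ncard_image fun x _ y _ hxy => ?_
  have h : Reachable (G.restrict ∅) x y := setOf_reachable_eq_iff.1 hxy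
  clear hxy
  induction h with
  | refl => rfl
  | tail _ h _ =>
    obtain ⟨f, hf, -⟩ := h
    exact hf.elim

theorem numComponents_insert_of_reachable (he : G.IsLink e u v)
    (h : Reachable (G.restrict A) u v) :
    numComponents G (insert e A) = numComponents G A := by
  have key : ∀ x y, Reachable (G.restrict (insert e A)) x y ↔ Reachable (G.restrict A) x y :=
    fun x y => ⟨fun h' => h'.restrict_subset_of_reachable he h,
      fun h' => h'.restrict_mono (Set.subset_insert _ _)⟩
  simp only [numComponents, componentSets, key, vertexSet_restrict]

/-- The classes of `u` and `v` are replaced by their union, and every other class is untouched. -/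
theorem numComponents_insert_of_not_reachable (hV : G.vertexSet.Finite) (he : G.IsLink e u v)
    (h : ¬ Reachable (G.restrict A) u v) :
    numComponents G (insert e A) + 1 = numComponents G A := by
  set c : α → Set α := fun x => {y | Reachable (G.restrict A) x y} with hc
  have hcu : c u ∈ componentSets (G.restrict A) := ⟨u, he.left_mem, rfl⟩
  have hcv : c v ∈ componentSets (G.restrict A) := ⟨v, he.right_mem, rfl⟩
  have hne : c u ≠ c v := fun h' => h (setOf_reachable_eq_iff.1 h')
  have hsub : A ⊆ insert e A := Set.subset_insert _ _
  have huv : Reachable (G.restrict (insert e A)) u v :=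
    .of_isLink (e := e) ⟨Set.mem_insert _ _, he⟩
  have hunion : {y | Reachable (G.restrict (insert e A)) u y} = c u ∪ c v := by
    ext y
    refine ⟨fun hy => ?_, ?_⟩
    · obtain h | ⟨-, h⟩ | ⟨-, h⟩ := reachable_restrict_insert he hy
      exacts [.inl h, .inr h, .inl h]
    · rintro (h | h)
      · exact Reachable.restrict_mono hsub h
      · exact huv.trans (Reachable.restrict_mono hsub h)
  have hother : ∀ x, ¬ Reachable (G.restrict A) u x → ¬ Reachable (G.restrict A) v x →
      {y | Reachable (G.restrict (insert e A)) x y} = c x := by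
    intro x hx hx'
    ext y
    refine ⟨fun hy => ?_, fun hy => Reachable.restrict_mono hsub hy⟩
    obtain h | ⟨h, -⟩ | ⟨h, -⟩ := reachable_restrict_insert he hy
    exacts [h, (hx h.symm).elim, (hx' h.symm).elim]
  have heq : componentSets (G.restrict (insert e A)) =
      insert (c u ∪ c v) (componentSets (G.restrict A) \ {c u, c v}) := by
    ext C
    constructor
    · rintro ⟨x, hx, rfl⟩
      by_cases hux : Reachable (G.restrict A) u x
      · left
        rw [← hunion]
        exact setOf_reachable_eq_iff.2 (hux.restrict_mono hsub).symm
      by_cases hvx : Reachable (G.restrict A) v x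
      · left
        rw [← hunion]
        exact setOf_reachable_eq_iff.2 (huv.trans (hvx.restrict_mono hsub)).symm
      right
      rw [hother x hux hvx]
      refine ⟨⟨x, hx, rfl⟩, ?_⟩
      rintro (h' | h')
      · exact hux (setOf_reachable_eq_iff.1 h').symm
      · exact hvx (setOf_reachable_eq_iff.1 h').symm
    · rintro (rfl | ⟨⟨x, hx, rfl⟩, hx'⟩)
      · exact ⟨u, he.left_mem, hunion.symm⟩
      · refine ⟨x, hx, (hother x (fun h' => hx' (.inl ?_)) fun h' => hx' (.inr ?_)).symm⟩
        · exact setOf_reachable_eq_iff.2 h'.symm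
        · exact setOf_reachable_eq_iff.2 h'.symm
  have hfin : (componentSets (G.restrict A)).Finite := componentSets_finite hV
  have hnot : c u ∪ c v ∉ componentSets (G.restrict A) \ {c u, c v} := by
    rintro ⟨⟨x, hx, hxe⟩, -⟩
    have h1 : u ∈ c u ∪ c v := .inl (.refl _ _)
    have h2 : v ∈ c u ∪ c v := .inr (.refl _ _)
    rw [hxe] at h1 h2
    exact h (Reachable.symm h1 |>.trans h2)
  have hpair : ({c u, c v} : Set (Set α)) ⊆ componentSets (G.restrict A) := by
    rintro C (rfl | rfl)
    exacts [hcu, hcv]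
  have h2 := Set.ncard_le_ncard hpair hfin
  rw [Set.ncard_pair hne] at h2
  rw [numComponents, numComponents, heq, Set.ncard_insert_of_notMem hnot hfin.sdiff,
    Set.ncard_sdiff hpair, Set.ncard_pair hne]
  omega

/-- The nullity (cyclomatic number) of the spanning subgraph with edge set `A`. -/
noncomputable def nullity (G : Graph α β) (A : Set β) : ℤ :=
  A.ncard + numComponents G A - G.vertexSet.ncard

theorem nullity_empty (G : Graph α β) : nullity G ∅ = 0 := by
  simp [nullity, numComponents_empty]

theorem nullity_insert_of_reachable (hA : A.Finite) (he : G.IsLink e u v) (heA : e ∉ A)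
    (h : Reachable (G.restrict A) u v) : nullity G (insert e A) = nullity G A + 1 := by
  rw [nullity, nullity, numComponents_insert_of_reachable he h,
    Set.ncard_insert_of_notMem heA hA]
  push_cast
  ring

theorem nullity_insert_of_not_reachable (hV : G.vertexSet.Finite) (hA : A.Finite)
    (he : G.IsLink e u v) (heA : e ∉ A) (h : ¬ Reachable (G.restrict A) u v) :
    nullity G (insert e A) = nullity G A := by
  have := numComponents_insert_of_not_reachable hV he h
  rw [nullity, nullity, Set.ncard_insert_of_notMem heA hA, ← this]
  push_cast
  ring

theorem nullity_le_insert (hV : G.vertexSet.Finite) (hA : A.Finite) (he : e ∈ G.edgeSet) :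
    nullity G A ≤ nullity G (insert e A) ∧ nullity G (insert e A) ≤ nullity G A + 1 := by
  obtain ⟨u, v, hl⟩ := G.exists_isLink_of_mem_edgeSet he
  by_cases heA : e ∈ A
  · rw [Set.insert_eq_of_mem heA]
    omega
  by_cases h : Reachable (G.restrict A) u v
  · rw [nullity_insert_of_reachable hA hl heA h]
    omega
  · rw [nullity_insert_of_not_reachable hV hA hl heA h]
    omega

theorem nullity_nonneg (hV : G.vertexSet.Finite) (hA : A.Finite) (hAE : A ⊆ G.edgeSet) :
    0 ≤ nullity G A := by
  induction A, hA using Set.Finite.induction_on with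
  | empty => exact (nullity_empty G).ge
  | insert _ hs ih =>
    exact (ih ((Set.subset_insert _ _).trans hAE)).trans
      (nullity_le_insert hV hs (hAE (Set.mem_insert _ _))).1

/-- Each deleted edge lowers the nullity by at most one. This is the lower bound for the circuit
rank. -/
theorem nullity_le_add_ncard (hV : G.vertexSet.Finite) (hJ : J.Finite) (hJE : J ⊆ G.edgeSet)
    (hB : B.Finite) : nullity G J ≤ nullity G (J \ B) + B.ncard := by
  induction B, hB using Set.Finite.induction_on with
  | empty => simp
  | @insert a s has hs ih =>
    rw [Set.ncard_insert_of_notMem has hs]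
    by_cases ha : a ∈ J
    · have : insert a (J \ insert a s) = J \ s := by
        ext b
        by_cases hb : b = a
        · subst hb
          simp [has, ha]
        · simp [hb]
      have h2 := (nullity_le_insert hV (hJ.subset (Set.sdiff_subset (t := insert a s)))
        (hJE ha)).2
      rw [this] at h2
      push_cast
      linarith
    · have : J \ insert a s = J \ s := by
        ext b
        by_cases hb : b = a
        · subst hb
          simp [ha]
        · simp [hb]
      rw [this]
      push_cast
      linarith

/-- Every edge of `J` lies on a closed trail in `J`: its ends stay connected when it is deleted. -/
def IsBridgeless (G : Graph α β) (J : Set β) : Prop :=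
  ∀ e ∈ J, ∀ u v, G.IsLink e u v → Reachable (G.restrict (J \ {e})) u v

/-- Every edge of `J` is a bridge of the spanning subgraph with edge set `J`. -/
def IsAcyclic (G : Graph α β) (J : Set β) : Prop :=
  ∀ e ∈ J, ∀ u v, G.IsLink e u v → ¬ Reachable (G.restrict (J \ {e})) u v

theorem IsAcyclic.subset (h : IsAcyclic G B) (hAB : A ⊆ B) : IsAcyclic G A :=
  fun e he u v hl hr => h e (hAB he) u v hl
    (hr.restrict_mono (Set.sdiff_subset_sdiff_left hAB))

/-- When an acyclic set is built edge by edge, each edge joins two different components, so the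
nullity stays 0. Conversely, an edge that is not a bridge contributes 1 on top of a nonnegative
nullity. -/
theorem isAcyclic_iff_nullity_eq_zero (hV : G.vertexSet.Finite) (hJ : J.Finite)
    (hJE : J ⊆ G.edgeSet) : IsAcyclic G J ↔ nullity G J = 0 := by
  constructor
  · intro h
    induction J, hJ using Set.Finite.induction_on with
    | empty => exact nullity_empty G
    | @insert a s has hs ih =>
      obtain ⟨u, v, hl⟩ := G.exists_isLink_of_mem_edgeSet (hJE (Set.mem_insert _ _))
      have := h a (Set.mem_insert _ _) u v hl
      rw [Set.insert_sdiff_self_of_notMem has] at this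
      rw [nullity_insert_of_not_reachable hV hs hl has this]
      exact ih ((Set.subset_insert _ _).trans hJE) (h.subset (Set.subset_insert _ _))
  · intro h e he u v hl hr
    have h1 := nullity_insert_of_reachable (hJ.subset Set.sdiff_subset) hl (by simp) hr
    rw [Set.insert_sdiff_singleton, Set.insert_eq_of_mem he] at h1
    have := nullity_nonneg hV (hJ.subset (Set.sdiff_subset (t := {e})))
      (Set.sdiff_subset.trans hJE)
    omega

/-- Greedy deletion: as long as some edge is not a bridge, deleting it lowers the nullity by exactly
one. This is the upper bound for the circuit rank. -/
theorem exists_isAcyclic_sdiff (hV : G.vertexSet.Finite) (hJ : J.Finite)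
    (hJE : J ⊆ G.edgeSet) :
    ∃ S ⊆ J, (S.ncard : ℤ) = nullity G J ∧ IsAcyclic G (J \ S) := by
  induction hn : J.ncard using Nat.strong_induction_on generalizing J with
  | _ n ih =>
    by_cases h : IsAcyclic G J
    · exact ⟨∅, Set.empty_subset _, by
        simp [(isAcyclic_iff_nullity_eq_zero hV hJ hJE).1 h], by simpa using h⟩
    simp only [IsAcyclic, not_forall, not_not] at h
    obtain ⟨e, he, u, v, hl, hr⟩ := h
    have hfin := hJ.subset (Set.sdiff_subset (t := {e}))
    obtain ⟨S, hS, hcard, hac⟩ := ih (J \ {e}).ncard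
      (hn ▸ Set.ncard_sdiff_singleton_lt_of_mem he hJ) hfin (Set.sdiff_subset.trans hJE) rfl
    have heS : e ∉ S := fun h => (hS h).2 rfl
    refine ⟨insert e S, Set.insert_subset he (hS.trans Set.sdiff_subset), ?_, ?_⟩
    · have h1 := nullity_insert_of_reachable hfin hl (by simp) hr
      rw [Set.insert_sdiff_singleton, Set.insert_eq_of_mem he] at h1
      rw [Set.ncard_insert_of_notMem heS (hfin.subset hS), h1]
      push_cast
      rw [hcard]
    · rwa [Set.sdiff_sdiff, Set.singleton_union] at hac

end Nullity

open Graph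

/-! ### Cycles, bridges, circuit rank, and the description of dual partitions through them. -/

section Cycles

variable {α β : Type*} {G : Graph α β} {A B J C : Set β} {e : β} {u v x y z : α}

/-- A walk of minimal length repeats no vertex. The walk is a function on `ℕ` whose values beyond
`n` are irrelevant. -/
theorem exists_shortest_path (h : Reachable G u v) :
    ∃ (n : ℕ) (p : ℕ → α), p 0 = u ∧ p n = v ∧ (∀ i < n, G.Adj (p i) (p (i + 1))) ∧
      Set.InjOn p (Set.Iic n) := by
  have hex : ∃ n, ∃ p : ℕ → α, p 0 = u ∧ p n = v ∧ ∀ i < n, G.Adj (p i) (p (i + 1)) := by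
    induction h with
    | refl => exact ⟨0, fun _ => u, rfl, rfl, by simp⟩
    | @tail b c _ h ih =>
      obtain ⟨n, p, h0, hn, hp⟩ := ih
      refine ⟨n + 1, fun i => if i ≤ n then p i else c, by simpa, by simp, fun i hi => ?_⟩
      obtain hi | rfl := Nat.lt_succ_iff_lt_or_eq.1 hi
      · simpa [hi.le, Nat.succ_le_of_lt hi] using hp i hi
      · simpa [hn] using h
  classical
  obtain ⟨p, h0, hn, hp⟩ := Nat.find_spec hex
  set n := Nat.find hex
  have key : ∀ i j, i < j → j ≤ n → p i ≠ p j := by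
    intro i j hij hj heq
    -- If `p i = p j`, cutting out the closed stretch from `i` to `j` gives a shorter walk.
    refine Nat.find_min hex (m := n - (j - i)) (by omega)
      ⟨fun k => if k ≤ i then p k else p (k + (j - i)), by simpa, ?_, fun k hk => ?_⟩
    · dsimp only
      split_ifs with h
      · have : j = n := by omega
        rw [show n - (j - i) = i by omega, heq, this, hn]
      · rw [Nat.sub_add_cancel (by omega), hn]
    · dsimp only
      rcases lt_trichotomy k i with h | rfl | h
      · rw [if_pos h.le, if_pos (by omega)]
        exact hp k (by omega)
      · rw [if_pos le_rfl, if_neg (by omega), heq, show k + 1 + (j - k) = j + 1 by omega]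
        exact hp j (by omega)
      · rw [if_neg (by omega), if_neg (by omega), show k + 1 + (j - i) = k + (j - i) + 1 by omega]
        exact hp _ (by omega)
  refine ⟨n, p, h0, hn, hp, fun i hi j hj hij => ?_⟩
  rcases lt_trichotomy i j with h | h | h
  exacts [(key i j h hj hij).elim, h, (key j i h hi hij.symm).elim]

/-- A shortest path from `u` to `v` avoiding `e` is closed up by `e`. If `e` is a loop the path has
length 0 and the cycle is `{e}`. -/
theorem exists_isCycleSet_of_reachable (he : G.IsLink e u v) (heJ : e ∈ J)
    (h : Reachable (G.restrict (J \ {e})) u v) : ∃ C ⊆ J, e ∈ C ∧ IsCycleSet G C := by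
  obtain ⟨n, p, h0, hn, hp, hinj⟩ := exists_shortest_path h
  have hf : ∀ i : ℕ, ∃ f, i < n → f ∈ J \ {e} ∧ G.IsLink f (p i) (p (i + 1)) := by
    intro i
    by_cases hi : i < n
    · obtain ⟨f, hf⟩ := hp i hi
      exact ⟨f, fun _ => hf⟩
    · exact ⟨e, fun h => (hi h).elim⟩
  choose f hf using hf
  let g : ℕ → β := fun i => if i < n then f i else e
  have hgn : ∀ i, i < n → g i = f i := fun i hi => if_pos hi
  have hgl : g n = e := if_neg (lt_irrefl _)
  refine ⟨Set.range fun i : Fin (n + 1) => g i, ?_, ⟨Fin.last n, by simpa using hgl⟩, n,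
    fun i => p i, fun i => g i, ?_, ?_, ?_, rfl⟩
  · rintro _ ⟨i, rfl⟩
    dsimp only
    by_cases hi : (i : ℕ) < n
    · rw [hgn _ hi]
      exact (hf _ hi).1.1
    · rwa [show (i : ℕ) = n by omega, hgl]
  · intro i j hij
    exact Fin.ext (hinj (Set.mem_Iic.2 (by omega)) (Set.mem_Iic.2 (by omega)) hij)
  -- Two equal path edges would have the same pair of ends, which the injectivity of the vertices
  -- forbids; no path edge equals `e`, since the path avoids it.
  · have key : ∀ i j, i < j → j ≤ n → g i ≠ g j := by
      intro i j hij hj heq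
      rw [hgn i (by omega)] at heq
      obtain hj | rfl := hj.lt_or_eq
      · rw [hgn j hj] at heq
        have h1 := (hf i (by omega)).2
        have h2 := (hf j hj).2
        rw [heq] at h1
        have inj : ∀ a b, a ≤ n → b ≤ n → p a = p b → a = b :=
          fun a b ha hb hab => hinj (Set.mem_Iic.2 ha) (Set.mem_Iic.2 hb) hab
        obtain ⟨h, h'⟩ | ⟨h, h'⟩ := h1.eq_and_eq_or_eq_and_eq h2
        · have := inj _ _ (by omega) (by omega) h
          omega
        · have := inj _ _ (by omega) (by omega) h
          omega
      · rw [hgl] at heq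
        exact (hf i hij).1.2 heq
    intro i j hij
    rcases lt_trichotomy i j with h | h | h
    exacts [(key i j h (by omega) hij).elim, h, (key j i h (by omega) hij.symm).elim]
  · intro i
    dsimp only
    by_cases hi : (i : ℕ) < n
    · rw [hgn _ hi, Fin.val_add_one_of_lt (Fin.lt_def.2 (by simpa using hi))]
      exact (hf _ hi).2
    · obtain rfl : i = Fin.last n := Fin.ext (by simp; omega)
      simp only [Fin.val_last, Fin.last_add_one, Fin.val_zero]
      rw [hgl, h0, hn]
      exact he.symm

open scoped Fin.NatCast Fin.CommRing in
-- Go around the cycle the other way: the `n` edges with indices `i + 1, …, i + n` lead from `p (i +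
-- 1)` back to `p i`.
theorem IsCycleSet.reachable (hC : IsCycleSet G C) (hCJ : C ⊆ J) (heC : e ∈ C)
    (he : G.IsLink e u v) : Reachable (G.restrict (J \ {e})) u v := by
  obtain ⟨n, p, f, -, hf, hl, rfl⟩ := hC
  obtain ⟨i, rfl⟩ := heC
  have key : ∀ k : ℕ, k ≤ n →
      Reachable (G.restrict (J \ {f i})) (p (i + 1)) (p (i + 1 + (k : Fin (n + 1)))) := by
    intro k hk
    induction k with
    | zero => simpa using Reachable.refl _ _
    | succ k ih =>
      refine (ih (by omega)).trans (.of_isLink (e := f (i + 1 + (k : Fin (n + 1)))) ⟨⟨hCJ ⟨_, rfl⟩,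
        fun h => ?_⟩, ?_⟩)
      · have h := hf h
        -- Meeting the edge `f i` again would need `k + 1 ≡ 0` modulo `n + 1`, although `0 < k + 1 ≤
        -- n`.
        have h2 : ((k + 1 : ℕ) : Fin (n + 1)) = 0 := by
          rw [add_assoc, add_eq_left] at h
          push_cast
          exact (add_comm (k : Fin (n + 1)) 1).trans h
        have := congrArg Fin.val h2
        rw [Fin.val_natCast, Nat.mod_eq_of_lt (by omega)] at this
        simp at this
      · have := hl (i + 1 + (k : Fin (n + 1)))
        push_cast
        rwa [← add_assoc]
  have h1 := key n le_rfl
  have h0 : i + 1 + ((n : ℕ) : Fin (n + 1)) = i := by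
    rw [add_assoc, add_eq_left]
    refine (add_comm (1 : Fin (n + 1)) _).trans ?_
    exact_mod_cast Fin.natCast_self (n + 1)
  rw [h0] at h1
  obtain ⟨rfl, rfl⟩ | ⟨rfl, rfl⟩ := he.eq_and_eq_or_eq_and_eq (hl i)
  exacts [h1.symm, h1]

/-- If no edge is a bridge, each edge lies on a cycle inside `J`, and the family of all cycles
inside `J` covers `J`. -/
theorem isUnionOfCycles_iff_isBridgeless (hJ : J ⊆ G.edgeSet) :
    IsUnionOfCycles G J ↔ IsBridgeless G J := by
  constructor
  · rintro ⟨𝒞, h𝒞, rfl⟩ e ⟨C, hC, heC⟩ u v he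
    exact (h𝒞 C hC).reachable (Set.subset_sUnion_of_mem hC) heC he
  · intro h
    refine ⟨{C | C ⊆ J ∧ IsCycleSet G C}, fun C hC => hC.2, Set.Subset.antisymm (fun e he => ?_)
      (Set.sUnion_subset fun C hC => hC.1)⟩
    obtain ⟨u, v, hl⟩ := G.exists_isLink_of_mem_edgeSet (hJ he)
    obtain ⟨C, hCJ, heC, hC⟩ := exists_isCycleSet_of_reachable hl he (h e he u v hl)
    exact ⟨C, ⟨hCJ, hC⟩, heC⟩

theorem edgeInduce_isLink : (edgeInduce G J).IsLink e x y ↔ e ∈ J ∧ G.IsLink e x y := by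
  simp only [edgeInduce, induce_isLink, restrict_isLink, Set.mem_ofPred_eq, and_iff_left_iff_imp]
  exact fun h => ⟨⟨e, h.1, h.2.inc_left⟩, ⟨e, h.1, h.2.inc_right⟩⟩

theorem edgeSet_edgeInduce (hJ : J ⊆ G.edgeSet) : (edgeInduce G J).edgeSet = J := by
  ext e
  rw [edge_mem_iff_exists_isLink]
  simp only [edgeInduce_isLink]
  refine ⟨fun ⟨_, _, h⟩ => h.1, fun h => ?_⟩
  obtain ⟨x, y, hl⟩ := G.exists_isLink_of_mem_edgeSet (hJ h)
  exact ⟨x, y, h, hl⟩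

/-- Only the links of `H` matter, not its vertex set; so this applies to `edgeInduce G J` with
further edges deleted, which keeps the vertices of `edgeInduce G J`. -/
theorem isForest_iff_isAcyclic (H : Graph α β)
    (hH : ∀ e x y, H.IsLink e x y ↔ e ∈ J ∧ G.IsLink e x y) :
    IsForest H ↔ IsAcyclic G J := by
  constructor
  · intro h e he u v hl hr
    obtain ⟨C, hCJ, heC, n, p, f, hp, hf, hlink, rfl⟩ := exists_isCycleSet_of_reachable hl he hr
    exact h _ ⟨n, p, f, hp, hf, fun i => (hH _ _ _).2 ⟨hCJ ⟨i, rfl⟩, hlink i⟩, rfl⟩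
  · rintro h C ⟨n, p, f, hp, hf, hlink, rfl⟩
    have hl := fun i => (hH _ _ _).1 (hlink i)
    refine h (f 0) (hl 0).1 _ _ (hl 0).2 (IsCycleSet.reachable
      ⟨n, p, f, hp, hf, fun i => (hl i).2, rfl⟩ ?_ ⟨0, rfl⟩ (hl 0).2)
    rintro _ ⟨i, rfl⟩
    exact (hl i).1

theorem circuitRank_edgeInduce (hV : G.vertexSet.Finite) (hJ : J.Finite)
    (hJE : J ⊆ G.edgeSet) : (circuitRank (edgeInduce G J) : ℤ) = nullity G J := by
  have key : ∀ S, IsForest ((edgeInduce G J).deleteEdges S) ↔ IsAcyclic G (J \ S) := by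
    intro S
    refine isForest_iff_isAcyclic _ fun e x y => ?_
    rw [deleteEdges_isLink, edgeInduce_isLink, Set.mem_sdiff]
    tauto
  rw [circuitRank, edgeSet_edgeInduce hJE]
  simp only [key]
  obtain ⟨S, hS, hcard, hac⟩ := exists_isAcyclic_sdiff hV hJ hJE
  rw [← hcard, Nat.cast_inj]
  refine le_antisymm (Nat.sInf_le ⟨S, hS, hJ.subset hS, rfl, hac⟩)
    (le_csInf ⟨_, S, hS, hJ.subset hS, rfl, hac⟩ ?_)
  rintro r ⟨T, hT, hTf, rfl, hTac⟩
  have h1 := nullity_le_add_ncard hV hJ hJE hTf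
  rw [(isAcyclic_iff_nullity_eq_zero hV (hJ.subset Set.sdiff_subset)
    (Set.sdiff_subset.trans hJE)).1 hTac, ← hcard] at h1
  omega

theorem reachable_edgeInduce : Reachable (edgeInduce G J) x y ↔ Reachable (G.restrict J) x y :=
  ⟨fun h => h.mono fun _ _ _ h => .of_isLink (edgeInduce_isLink.1 h),
    fun h => h.mono fun _ _ _ h => .of_isLink (edgeInduce_isLink.2 h)⟩

/-- Deleting `e` keeps its component connected exactly if the ends of `e` stay joined, because any
walk through `e` can then be rerouted. -/
theorem mem_dualConnectedPartitions_iff :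
    J ∈ dualConnectedPartitions G ↔ J ⊆ G.edgeSet ∧ IsBridgeless G J := by
  refine and_congr_right fun hJ => ⟨fun h e he u v hl => ?_, ?_⟩
  · have hl' : (edgeInduce G J).IsLink e u v := edgeInduce_isLink.2 ⟨he, hl⟩
    have huC : u ∈ {x | Reachable (edgeInduce G J) u x} := .refl _ _
    have hvC : v ∈ {x | Reachable (edgeInduce G J) u x} := .of_isLink hl'
    have hlC : ((edgeInduce G J).induce {x | Reachable (edgeInduce G J) u x}).IsLink e u v :=
      ⟨hl', huC, hvC⟩
    have := ((h _ ⟨u, hl'.left_mem, rfl⟩).2 e hlC.edge_mem).2 u huC v hvC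
    refine this.mono fun f x y hf => ?_
    rw [deleteEdges_isLink] at hf
    have hf' := edgeInduce_isLink.1 hf.1.1
    exact .of_isLink (e := f) ⟨⟨hf'.1, hf.2⟩, hf'.2⟩
  · rintro h C ⟨u, hu, rfl⟩
    set K := (edgeInduce G J).induce {x | Reachable (edgeInduce G J) u x} with hK
    -- A walk in `J` that starts in the component of `u` stays in it, so it is a walk in the induced
    -- subgraph `K`.
    have main : ∀ e (x y : α), Reachable (edgeInduce G J) u x →
        Reachable (G.restrict (J \ {e})) x y → Reachable (K.deleteEdges {e}) x y := by
      intro e x y hx h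
      induction h with
      | refl => exact .refl _ _
      | @tail b c h' hbc ih =>
        obtain ⟨f, ⟨hfJ, hfe⟩, hfl⟩ := hbc
        have hl : (edgeInduce G J).IsLink f b c := edgeInduce_isLink.2 ⟨hfJ, hfl⟩
        have hub : Reachable (edgeInduce G J) u b :=
          hx.trans (reachable_edgeInduce.2 (Reachable.restrict_mono Set.sdiff_subset h'))
        refine ih.trans (.of_isLink (e := f) ?_)
        rw [deleteEdges_isLink]
        exact ⟨⟨hl, hub, hub.trans (.of_isLink hl)⟩, hfe⟩
    have conn : ∀ e ∈ J, IsConn (K.deleteEdges {e}) := by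
      intro e he
      refine ⟨⟨u, .refl _ _⟩, fun x hx y hy => main e x y hx ?_⟩
      have hxy : Reachable (G.restrict J) x y :=
        reachable_edgeInduce.1 (Reachable.trans (Reachable.symm hx) hy)
      obtain ⟨a, b, hl⟩ := G.exists_isLink_of_mem_edgeSet (hJ he)
      refine Reachable.restrict_subset_of_reachable (e := e) ?_ hl (h e he a b hl)
      rwa [Set.insert_sdiff_singleton, Set.insert_eq_of_mem he]
    refine ⟨?_, fun e he => conn e ?_⟩
    -- Every vertex of `G[J]` is an end of some edge of `J`, so connectedness of `K` follows from
    -- connectedness after deleting that edge.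
    · obtain ⟨e, he, -⟩ := hu
      have := conn e he
      exact ⟨this.1, fun x hx y hy => (this.2 x hx y hy).mono fun f a b hf => .of_isLink (e := f)
        (by rw [deleteEdges_isLink] at hf; exact hf.1)⟩
    · obtain ⟨x, y, hl, -⟩ := he
      exact (edgeInduce_isLink.1 hl).1

theorem mem_dualPartitions_iff (hV : G.vertexSet.Finite) (hJ : J.Finite) {k : ℕ} :
    J ∈ dualPartitions G k ↔ J ⊆ G.edgeSet ∧ IsBridgeless G J ∧ nullity G J + 1 = k := by
  rw [dualPartitions, Set.mem_ofPred_eq, mem_dualConnectedPartitions_iff, and_assoc]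
  refine and_congr_right fun hJE => and_congr_right fun _ => ?_
  rw [← circuitRank_edgeInduce hV hJ hJE]
  norm_cast

end Cycles

open Graph

/-! ### Duality of component counts, from the rotation system and Euler's formula. -/

section Components

variable {α β : Type*} {G : Graph α β} {A : Set β} {k : ℕ}

theorem numComponents_eq_one (hG : IsConn (G.restrict A)) : numComponents G A = 1 := by
  obtain ⟨⟨u, hu⟩, h⟩ := hG
  rw [numComponents, Set.ncard_eq_one]
  refine ⟨{v | Reachable (G.restrict A) u v}, Set.ext fun C => ⟨?_, ?_⟩⟩
  · rintro ⟨v, hv, rfl⟩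
    exact setOf_reachable_eq_iff.2 (h v hv u hu)
  · rintro rfl
    exact ⟨u, hu, rfl⟩

end Components

namespace RotationSystem

variable {V E : Type*} (M : RotationSystem V E) {A J : Set E}

theorem graph_isLink (e : E) : M.graph.IsLink e (M.tail (e, false)) (M.tail (e, true)) :=
  ⟨false, rfl, rfl⟩

theorem dual_isLink (e : E) :
    M.dual.IsLink ⟨e⟩ (M.faceOf (e, false)) (M.faceOf (e, true)) :=
  ⟨false, rfl, rfl⟩

theorem faceOf_next (d : E × Bool) : M.faceOf (M.next d) = M.faceOf (rev E d) := by
  have : M.faceNext (rev E d) = M.next d := by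
    simp [faceNext, rev]
  rw [← this]
  refine congrArg Sum.inl (Quotient.sound ?_)
  exact Equiv.Perm.sameCycle_apply_left.2 (Equiv.Perm.SameCycle.refl _ _)

theorem tail_next (d : E × Bool) : M.tail (M.next d) = M.tail d :=
  (M.sameCycle_iff _ _).1 (Equiv.Perm.sameCycle_apply_left.2 (Equiv.Perm.SameCycle.refl _ _))

theorem dual_reachable_rev (d : E × Bool) :
    Reachable M.dual (M.faceOf d) (M.faceOf (rev E d)) :=
  .of_isLink (e := ⟨d.1⟩) ⟨d.2, rfl, rfl⟩

/-- Rotating around a vertex from `d` to `next d` crosses the edge of `d`, by `faceOf_next`; so all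
faces around a vertex are joined in the dual. -/
theorem dual_reachable_of_tail_eq [Finite E] {d d' : E × Bool} (h : M.tail d = M.tail d') :
    Reachable M.dual (M.faceOf d) (M.faceOf d') := by
  obtain ⟨n, rfl⟩ := ((M.sameCycle_iff _ _).2 h).exists_nat_pow_eq
  clear h
  induction n with
  | zero => exact .refl _ _
  | succ n ih =>
    rw [pow_succ', Equiv.Perm.mul_apply, faceOf_next]
    exact ih.trans (M.dual_reachable_rev _)

theorem isConn_dual [Finite E] (h : IsConn M.graph) : IsConn M.dual := by
  have key : ∀ d d', Reachable M.dual (M.faceOf d) (M.faceOf d') := by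
    intro d d'
    have := h.2 (M.tail d) trivial (M.tail d') trivial
    suffices ∀ v, Reachable M.graph (M.tail d) v → ∀ d', M.tail d' = v →
        Reachable M.dual (M.faceOf d) (M.faceOf d') from this _ (h.2 _ trivial _ trivial) _ rfl
    intro v hv
    induction hv with
    | refl => exact fun d' h => M.dual_reachable_of_tail_eq h.symm
    | @tail b c _ hbc ih =>
      rintro d' rfl
      obtain ⟨e, i, rfl, hc⟩ := hbc
      exact (ih _ rfl).trans ((M.dual_reachable_rev _).trans (M.dual_reachable_of_tail_eq hc))
  refine ⟨?_, ?_⟩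
  -- Without edges the only face is the extra one; otherwise a dart supplies a face.
  · by_cases hE : IsEmpty E
    · exact ⟨Sum.inr ⟨hE⟩, trivial⟩
    · obtain ⟨e⟩ := not_isEmpty_iff.1 hE
      exact ⟨M.faceOf (e, false), trivial⟩
  · rintro (⟨⟨d⟩⟩ | ⟨hE⟩) - (⟨⟨d'⟩⟩ | ⟨hE'⟩) -
    · exact key d d'
    · exact hE'.down.elim d.1
    · exact hE.down.elim d'.1
    · exact Subsingleton.elim hE hE' ▸ .refl _ _

/-- Suppose `e` separates both in the primal and in the dual. Let `ψ` be the indicator of the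
component of one end of `e` in `A`, and `φ` that of the component of one side of `e` among the dual
edges outside `insert e A`. The sum over all edges of the product of the jumps of `ψ` and `φ`
vanishes in every rotation system, but only `e` contributes, and it contributes 1. -/
theorem reachable_of_not_dual_reachable [Finite E] (e : E)
    (h : ¬ Reachable (M.dual.restrict (dualEdges E (insert e A)ᶜ))
      (M.faceOf (e, false)) (M.faceOf (e, true))) :
    Reachable (M.graph.restrict A) (M.tail (e, false)) (M.tail (e, true)) := by
  classical
  have := Fintype.ofFinite E
  by_contra hn
  set R := M.dual.restrict (dualEdges E (insert e A)ᶜ)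
  let φ : E × Bool → ℤ := fun d => if Reachable R (M.faceOf (e, false)) (M.faceOf d) then 1 else 0
  let ψ : E × Bool → ℤ := fun d =>
    if Reachable (M.graph.restrict A) (M.tail (e, false)) (M.tail d) then 1 else 0
  -- Reindex by `next`, which preserves tails and sends the face of `rev d` to that of `next d`.
  have h1 : ∑ d, ψ d * φ (rev E d) = ∑ d, ψ d * φ d := by
    rw [← Equiv.sum_comp M.next fun d => ψ d * φ d]
    exact Finset.sum_congr rfl fun d _ => by simp only [φ, ψ, faceOf_next, tail_next]
  -- Grouping the two darts of each edge turns the difference of the two sums into minus the sum of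
  -- products of jumps.
  have h2 : ∑ a, (ψ (a, true) - ψ (a, false)) * (φ (a, true) - φ (a, false)) = 0 := by
    rw [Fintype.sum_prod_type, Fintype.sum_prod_type, ← sub_eq_zero, ← Finset.sum_sub_distrib]
      at h1
    rw [← neg_eq_zero, ← Finset.sum_neg_distrib]
    refine Eq.trans (Finset.sum_congr rfl fun a _ => ?_) h1
    simp only [Fintype.sum_bool, rev, Equiv.coe_fn_mk, Bool.not_true, Bool.not_false]
    ring
  rw [Finset.sum_eq_single e] at h2
  · have e1 : ψ (e, false) = 1 := if_pos (.refl _ _)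
    have e2 : ψ (e, true) = 0 := if_neg hn
    have e3 : φ (e, false) = 1 := if_pos (.refl _ _)
    have e4 : φ (e, true) = 0 := if_neg h
    rw [e1, e2, e3, e4] at h2
    norm_num at h2
  · intro a _ hae
    -- For another edge one factor is zero: `ψ` is constant along edges of `A`, and `φ` across edges
    -- outside `insert e A`.
    by_cases ha : a ∈ A
    · have hl : Reachable (M.graph.restrict A) (M.tail (a, false)) (M.tail (a, true)) :=
        .of_isLink (e := a) ⟨ha, M.graph_isLink a⟩
      have : ψ (a, true) = ψ (a, false) := by
        simp only [ψ]
        congr 1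
        exact propext ⟨fun h => h.trans hl.symm, fun h => h.trans hl⟩
      rw [this, sub_self, zero_mul]
    · have hl : Reachable R (M.faceOf (a, false)) (M.faceOf (a, true)) :=
        .of_isLink (e := ⟨a⟩) ⟨fun h => h.elim hae ha, M.dual_isLink a⟩
      have : φ (a, true) = φ (a, false) := by
        simp only [φ]
        congr 1
        exact propext ⟨fun h => h.trans hl.symm, fun h => h.trans hl⟩
      rw [this, sub_self, mul_zero]
  · exact fun h => (h (Finset.mem_univ _)).elim

instance [Finite E] : Finite M.Face :=
  inferInstanceAs (Finite (Quotient _ ⊕ PLift (IsEmpty E)))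

instance [Finite E] : Finite (DualEdge E) :=
  Finite.of_injective DualEdge.primal fun _ _ => DualEdge.ext

/-- Adding one edge gains 1 from the cardinality and loses 1 for a primal merger and 1 for a dual
separation, which exclude each other by `reachable_of_not_dual_reachable`. -/
theorem ncard_add_numComponents_le [Finite V] [Finite E] {B : Set E} (hAB : A ⊆ B) :
    (A.ncard + numComponents M.graph A - numComponents M.dual (dualEdges E Aᶜ) : ℤ) ≤
      B.ncard + numComponents M.graph B - numComponents M.dual (dualEdges E Bᶜ) := by
  suffices ∀ S : Set E, (A.ncard + numComponents M.graph A -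
      numComponents M.dual (dualEdges E Aᶜ) : ℤ) ≤ (S ∪ A).ncard + numComponents M.graph (S ∪ A) -
      numComponents M.dual (dualEdges E (S ∪ A)ᶜ) by
    simpa [Set.union_eq_self_of_subset_right hAB] using this B
  intro S
  induction S, S.toFinite using Set.Finite.induction_on with
  | empty => simp
  | @insert e S _ _ ih =>
    refine ih.trans ?_
    rw [Set.insert_union]
    generalize S ∪ A = T
    by_cases heT : e ∈ T
    · rw [Set.insert_eq_of_mem heT]
    have hD : dualEdges E Tᶜ = insert ⟨e⟩ (dualEdges E (insert e T)ᶜ) := by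
      ext ⟨a⟩
      change a ∉ T ↔ _ = _ ∨ a ∉ insert e T
      by_cases ha : a = e
      · simp [ha, heT]
      · simp [ha]
    rw [Set.ncard_insert_of_notMem heT, hD]
    push_cast
    have hF : M.dual.vertexSet.Finite := Set.toFinite _
    have hV : M.graph.vertexSet.Finite := Set.finite_univ
    by_cases hd : Reachable (M.dual.restrict (dualEdges E (insert e T)ᶜ))
      (M.faceOf (e, false)) (M.faceOf (e, true))
    · rw [numComponents_insert_of_reachable (M.dual_isLink e) hd]
      by_cases hp : Reachable (M.graph.restrict T) (M.tail (e, false)) (M.tail (e, true))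
      · rw [numComponents_insert_of_reachable (M.graph_isLink e) hp]
        omega
      · have := numComponents_insert_of_not_reachable hV (M.graph_isLink e) hp
        omega
    · have h1 := numComponents_insert_of_not_reachable hF (M.dual_isLink e) hd
      rw [numComponents_insert_of_reachable (M.graph_isLink e)
        (M.reachable_of_not_dual_reachable e hd)]
      omega

theorem restrict_univ_isConn {α β : Type*} {G : Graph α β} (h : IsConn G) :
    IsConn (G.restrict Set.univ) :=
  ⟨h.1, fun u hu v hv => (h.2 u hu v hv).mono fun e _ _ hl => .of_isLink (e := e) ⟨trivial, hl⟩⟩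

/-- The nullity of a set of edges of the dual of a connected plane graph `G` is one less than the
number of components that remain when the corresponding edges are deleted from `G`. -/
theorem nullity_dual [Finite V] [Finite E] (hM : M.IsConnectedPlane) (J : Set E) :
    nullity M.dual (dualEdges E J) + 1 = numComponents M.graph Jᶜ := by
  -- The value at `Jᶜ` lies between those at `∅` and at `univ`, namely |V| - 1 and |E| + 1 - |F|;
  -- these coincide by Euler's formula.
  have h0 := M.ncard_add_numComponents_le (Set.empty_subset Jᶜ)
  have h1 := M.ncard_add_numComponents_le (Set.subset_univ Jᶜ)
  have hG := numComponents_eq_one (restrict_univ_isConn hM.1)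
  have hD := numComponents_eq_one (restrict_univ_isConn (M.isConn_dual hM.1))
  have hu : dualEdges E Set.univ = Set.univ := rfl
  have he : dualEdges E ∅ = ∅ := rfl
  have hV : M.graph.vertexSet.ncard = Nat.card V := Set.ncard_univ V
  have hF : M.dual.vertexSet.ncard = Nat.card M.Face := Set.ncard_univ _
  have hchi := hM.2
  have hJ : (dualEdges E J).ncard = J.ncard := by
    have : dualEdges E J = DualEdge.mk '' J := by
      ext ⟨a⟩
      simp [dualEdges]
    rw [this, Set.ncard_image_of_injective J fun a b h => by simpa using h]
  have hc := Set.ncard_add_ncard_compl J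
  rw [numComponents_empty, Set.ncard_empty, Set.compl_empty, hu, hD, hV, compl_compl] at h0
  rw [Set.compl_univ, he, numComponents_empty, hG, Set.ncard_univ, hF, compl_compl] at h1
  rw [eulerChar] at hchi
  rw [nullity, hJ, hF]
  push_cast at *
  omega

/-- Apply `nullity_dual` to `J` and to `J \ {e}`. Deleting the dual edge lowers the nullity exactly
if it is not a bridge; restoring `e` in the primal lowers the number of components exactly if its
ends were separated. -/
theorem reachable_dual_iff [Finite V] [Finite E] (hM : M.IsConnectedPlane) {e : E} (he : e ∈ J) :
    Reachable (M.dual.restrict (dualEdges E J \ {⟨e⟩}))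
      (M.faceOf (e, false)) (M.faceOf (e, true)) ↔
      ¬ Reachable (M.graph.restrict Jᶜ) (M.tail (e, false)) (M.tail (e, true)) := by
  have h1 := M.nullity_dual hM J
  have h2 := M.nullity_dual hM (J \ {e})
  have hD : dualEdges E (J \ {e}) = dualEdges E J \ {⟨e⟩} := by
    ext ⟨a⟩
    simp [dualEdges]
  have hJ : insert ⟨e⟩ (dualEdges E J \ {⟨e⟩}) = dualEdges E J := by
    rw [Set.insert_sdiff_singleton, Set.insert_eq_of_mem]
    exact he
  have hc : (J \ {e})ᶜ = insert e Jᶜ := by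
    ext a
    by_cases ha : a = e <;> simp [ha]
  rw [hD, hc] at h2
  rw [← hJ] at h1
  have hF : M.dual.vertexSet.Finite := Set.toFinite _
  have hV : M.graph.vertexSet.Finite := Set.finite_univ
  constructor
  · intro h h'
    rw [nullity_insert_of_reachable (Set.toFinite _) (M.dual_isLink e) (by simp) h] at h1
    rw [numComponents_insert_of_reachable (M.graph_isLink e) h'] at h2
    omega
  · intro h
    by_contra h'
    rw [nullity_insert_of_not_reachable hF (Set.toFinite _) (M.dual_isLink e) (by simp) h'] at h1
    have := numComponents_insert_of_not_reachable hV (M.graph_isLink e) h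
    omega

/-- The edges of `J` join different components of `G ∖ J`. -/
def IsUnionOfCuts (J : Set E) : Prop :=
  ∀ e ∈ J, ¬ Reachable (M.graph.restrict Jᶜ) (M.tail (e, false)) (M.tail (e, true))

theorem isBridgeless_dualEdges_iff [Finite V] [Finite E] (hM : M.IsConnectedPlane) :
    IsBridgeless M.dual (dualEdges E J) ↔ M.IsUnionOfCuts J := by
  constructor
  · intro h e he
    exact (M.reachable_dual_iff hM he).1 (h ⟨e⟩ he _ _ (M.dual_isLink e))
  · rintro h ⟨e⟩ he u v hl
    have := (M.reachable_dual_iff hM he).2 (h e he)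
    obtain ⟨rfl, rfl⟩ | ⟨rfl, rfl⟩ := hl.eq_and_eq_or_eq_and_eq (M.dual_isLink e)
    exacts [this, this.symm]

theorem dualEdges_mem_dualPartitions_iff [Finite V] [Finite E] (hM : M.IsConnectedPlane) {k : ℕ} :
    dualEdges E J ∈ dualPartitions M.dual k ↔
      M.IsUnionOfCuts J ∧ numComponents M.graph Jᶜ = k := by
  rw [mem_dualPartitions_iff (Set.toFinite _) (Set.toFinite _), isBridgeless_dualEdges_iff _ hM,
    nullity_dual _ hM]
  norm_cast
  exact and_iff_right (Set.subset_univ _)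

end RotationSystem

/-! ### Connected partitions as component partitions. -/

section Cuts

variable {α β : Type*} {G : Graph α β} {A J : Set β} {P : Set (Set α)} {k : ℕ}

theorem comp_eq_componentSets (G : Graph α β) (hG : G.edgeSet = Set.univ) (J : Set β) :
    comp G J = componentSets (G.restrict Jᶜ) := by
  rw [comp, restrict_eq_deleteEdges, hG, Set.sdiff_compl, Set.univ_inter]

/-- Leaving a block requires an edge of the cut. -/
theorem eq_of_reachable_cut (hP : P ∈ connectedPartitions G k) {B : Set α} (hB : B ∈ P) {x y : α}
    (hx : x ∈ B) (h : Reachable (G.restrict (cut G P)ᶜ) x y) : y ∈ B := by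
  obtain ⟨-, -, hU, -⟩ := hP
  induction h with
  | refl => exact hx
  | @tail b c _ h ih =>
    obtain ⟨f, hf, hl⟩ := h
    obtain ⟨C, hC, hcC⟩ : c ∈ ⋃₀ P := hU ▸ hl.right_mem
    by_cases hBC : B = C
    · exact hBC ▸ hcC
    · exact (hf ⟨B, hB, C, hC, hBC, _, ih, _, hcC, hl⟩).elim

theorem setOf_reachable_cut (hP : P ∈ connectedPartitions G k) {B : Set α} (hB : B ∈ P) {x : α}
    (hx : x ∈ B) : {y | Reachable (G.restrict (cut G P)ᶜ) x y} = B := by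
  refine Set.Subset.antisymm (fun y hy => eq_of_reachable_cut hP hB hx hy) fun y hy => ?_
  refine ((hP.2.2.2 B hB).2 x hx y hy).mono fun e a b (hl : _ ∧ _ ∧ _) => .of_isLink (e := e) ⟨?_, hl.1⟩
  -- An edge inside the block `B` is not in the cut, since by disjointness both of its ends belong
  -- to no block but `B`.
  rintro ⟨C, hC, D, hD, hne, u, hu, v, hv, hl'⟩
  have key : ∀ z C, C ∈ P → z ∈ B → z ∈ C → C = B := by
    intro z C hC hzB hzC
    by_contra hCB
    exact Set.disjoint_left.1 (hP.2.1 hC hB hCB) hzC hzB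
  obtain ⟨rfl, rfl⟩ | ⟨rfl, rfl⟩ := hl'.eq_and_eq_or_eq_and_eq hl.1
  · exact hne ((key u C hC hl.2.1 hu).trans (key v D hD hl.2.2 hv).symm)
  · exact hne ((key _ C hC hl.2.2 hu).trans (key _ D hD hl.2.1 hv).symm)

theorem componentSets_cut (hP : P ∈ connectedPartitions G k) :
    componentSets (G.restrict (cut G P)ᶜ) = P := by
  ext B
  constructor
  · rintro ⟨x, hx, rfl⟩
    obtain ⟨B, hB, hxB⟩ : x ∈ ⋃₀ P := hP.2.2.1 ▸ hx
    rwa [setOf_reachable_cut hP hB hxB]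
  · intro hB
    obtain ⟨x, hx⟩ := (hP.2.2.2 B hB).1
    exact ⟨x, hP.2.2.1 ▸ ⟨B, hB, hx⟩, (setOf_reachable_cut hP hB hx).symm⟩

theorem componentSets_mem_connectedPartitions (hV : G.vertexSet.Finite)
    (hk : numComponents G A = k) : componentSets (G.restrict A) ∈ connectedPartitions G k := by
  have hfin : (componentSets (G.restrict A)).Finite := componentSets_finite hV
  refine ⟨?_, ?_, ?_, ?_⟩
  · rw [← hk, numComponents, hfin.cast_ncard_eq]
  · rintro _ ⟨x, hx, rfl⟩ _ ⟨y, hy, rfl⟩ hne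
    refine Set.disjoint_left.2 fun z hz hz' => hne ?_
    exact setOf_reachable_eq_iff.2 (Reachable.trans hz (Reachable.symm hz'))
  · ext x
    constructor
    · rintro ⟨_, ⟨y, hy, rfl⟩, hyx⟩
      exact Reachable.mem_vertexSet (G := G.restrict A) hyx hy
    · exact fun hx => ⟨_, ⟨x, hx, rfl⟩, .refl _ _⟩
  · rintro _ ⟨u, hu, rfl⟩
    refine ⟨⟨u, .refl _ _⟩, fun x hx y hy => ?_⟩
    have hxy : Reachable (G.restrict A) x y := (Reachable.symm hx).trans hy
    clear hy
    induction hxy with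
    | refl => exact .refl _ _
    | @tail b c h hbc ih =>
      refine ih.trans ?_
      obtain ⟨f, hf⟩ := hbc
      have hb : Reachable (G.restrict A) u b := Reachable.trans hx h
      exact .of_isLink (e := f) ⟨hf.2, hb, hb.trans (.of_isLink hf)⟩

end Cuts

/-! ### The two maps are inverse bijections. -/

namespace RotationSystem

variable {V E : Type*} (M : RotationSystem V E) {J : Set E} {k : ℕ}

theorem isUnionOfCuts_cut {P : Set (Set V)} (hP : P ∈ connectedPartitions M.graph k) :
    M.IsUnionOfCuts (cut M.graph P) := by
  rintro e ⟨B, hB, C, hC, hne, u, hu, v, hv, hl⟩ h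
  have huv : Reachable (M.graph.restrict (cut M.graph P)ᶜ) u v := by
    obtain ⟨rfl, rfl⟩ | ⟨rfl, rfl⟩ := hl.eq_and_eq_or_eq_and_eq (M.graph_isLink e)
    exacts [h, h.symm]
  exact Set.disjoint_left.1 (hP.2.1 hB hC hne) (eq_of_reachable_cut hP hB hu huv) hv

/-- An edge outside `J` never joins two components of `G ∖ J`; that every edge of `J` does is the
hypothesis. -/
theorem cut_componentSets (hJ : M.IsUnionOfCuts J) :
    cut M.graph (componentSets (M.graph.restrict Jᶜ)) = J := by
  ext e
  constructor
  · rintro ⟨_, ⟨x, hx, rfl⟩, _, ⟨y, hy, rfl⟩, hne, u, hu, v, hv, hl⟩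
    by_contra he
    refine hne (setOf_reachable_eq_iff.2 ?_)
    exact Reachable.trans hu (Reachable.trans (.of_isLink (e := e) ⟨he, hl⟩) (Reachable.symm hv))
  · intro he
    exact ⟨_, ⟨_, trivial, rfl⟩, _, ⟨_, trivial, rfl⟩,
      fun h => hJ e he (setOf_reachable_eq_iff.1 h), _, .refl _ _, _, .refl _ _, M.graph_isLink e⟩

theorem mem_dualPartitions_iff_isUnionOfCycles (J : Set (DualEdge E)) :
    J ∈ dualPartitions M.dual k ↔
      IsUnionOfCycles M.dual J ∧ circuitRank (edgeInduce M.dual J) + 1 = k := by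
  have hJ : J ⊆ M.dual.edgeSet := Set.subset_univ _
  rw [dualPartitions, Set.mem_ofPred_eq, mem_dualConnectedPartitions_iff,
    isUnionOfCycles_iff_isBridgeless hJ, and_iff_right hJ]

variable [Finite V] [Finite E]

theorem mapsTo_dualCut (hM : M.IsConnectedPlane) :
    Set.MapsTo M.dualCut (connectedPartitions M.graph k) (dualPartitions M.dual k) := by
  intro P hP
  refine (M.dualEdges_mem_dualPartitions_iff hM).2 ⟨M.isUnionOfCuts_cut hP, ?_⟩
  rw [numComponents, componentSets_cut hP, Set.ncard_def, hP.1]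
  rfl

theorem mapsTo_compDual (hM : M.IsConnectedPlane) :
    Set.MapsTo M.compDual (dualPartitions M.dual k) (connectedPartitions M.graph k) := by
  intro J hJ
  rw [← (dualEdges E).apply_symm_apply J, M.dualEdges_mem_dualPartitions_iff hM] at hJ
  rw [compDual, comp_eq_componentSets _ rfl]
  exact componentSets_mem_connectedPartitions Set.finite_univ hJ.2

theorem invOn_compDual_dualCut (hM : M.IsConnectedPlane) :
    Set.InvOn M.compDual M.dualCut (connectedPartitions M.graph k) (dualPartitions M.dual k) := by
  constructor
  · intro P hP
    rw [compDual, dualCut, Equiv.symm_apply_apply, comp_eq_componentSets _ rfl,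
      componentSets_cut hP]
  · intro J hJ
    rw [← (dualEdges E).apply_symm_apply J, M.dualEdges_mem_dualPartitions_iff hM] at hJ
    rw [compDual, dualCut, comp_eq_componentSets _ rfl, M.cut_componentSets hJ.1,
      Equiv.apply_symm_apply]

theorem bijOn_dualCut (hM : M.IsConnectedPlane) :
    Set.BijOn M.dualCut (connectedPartitions M.graph k) (dualPartitions M.dual k) :=
  (M.invOn_compDual_dualCut hM).bijOn (M.mapsTo_dualCut hM) (M.mapsTo_compDual hM)

theorem bijOn_compDual (hM : M.IsConnectedPlane) :
    Set.BijOn M.compDual (dualPartitions M.dual k) (connectedPartitions M.graph k) :=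
  (M.invOn_compDual_dualCut hM).symm.bijOn (M.mapsTo_compDual hM) (M.mapsTo_dualCut hM)

end RotationSystem

/-! ### A structured language of stack programs and its compilation to `TM2` machines. -/

namespace StackProgram

open Function Turing

/-- The registers of a stack program: the symbol popped last and a bit. -/
abbrev Regs : Type := Option Bool × Bool

/-- The registers and the stacks. -/
abbrev State (K : Type) : Type := Regs × (K → List Bool)

/-- Structured programs over finitely many stacks of bits. `loop k p c` pops the stack `k` and
repeats `c`, as long as the popped symbol satisfies `p`. -/
inductive Cmd (K : Type) : Type
  | push (k : K) (f : Regs → Bool)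
  | pop (k : K)
  | load (f : Regs → Regs)
  | seq (c d : Cmd K)
  | ite (p : Regs → Bool) (c d : Cmd K)
  | loop (k : K) (p : Option Bool → Bool) (c : Cmd K)

variable {K : Type}

/-- The labels of the machine that runs a program. -/
def Cmd.Label : Cmd K → Type
  | .push _ _ => Unit
  | .pop _ => Unit
  | .load _ => Unit
  | .seq c d => c.Label ⊕ d.Label
  | .ite _ c d => Option (c.Label ⊕ d.Label)
  | .loop _ _ c => Option c.Label

instance Cmd.finite_label : (c : Cmd K) → Finite c.Label
  | .push _ _ => inferInstanceAs (Finite Unit)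
  | .pop _ => inferInstanceAs (Finite Unit)
  | .load _ => inferInstanceAs (Finite Unit)
  | .seq c d =>
    have := c.finite_label
    have := d.finite_label
    inferInstanceAs (Finite (c.Label ⊕ d.Label))
  | .ite _ c d =>
    have := c.finite_label
    have := d.finite_label
    inferInstanceAs (Finite (Option (c.Label ⊕ d.Label)))
  | .loop _ _ c =>
    have := c.finite_label
    inferInstanceAs (Finite (Option c.Label))

/-- The label at which a program starts. -/
def Cmd.entry : (c : Cmd K) → c.Label
  | .push _ _ => ()
  | .pop _ => ()
  | .load _ => ()
  | .seq c _ => Sum.inl c.entry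
  | .ite _ _ _ => none
  | .loop _ _ _ => none

/-- The statements of the machine that runs a program and then jumps to the label `x`. -/
def Cmd.code {Λ : Type} : (c : Cmd K) → (c.Label → Λ) → Λ → c.Label →
    TM2.Stmt (fun _ : K => Bool) Λ Regs
  | .push k f, _, x, _ => .push k f (.goto fun _ => x)
  | .pop k, _, x, _ => .pop k (fun v b => (b, v.2)) (.goto fun _ => x)
  | .load f, _, x, _ => .load f (.goto fun _ => x)
  | .seq c d, i, x, l =>
    Sum.elim (c.code (fun l => i (Sum.inl l)) (i (Sum.inr d.entry)))
      (d.code (fun l => i (Sum.inr l)) x) l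
  | .ite p c d, i, x, l =>
    Option.elim l (.branch p (.goto fun _ => i (some (Sum.inl c.entry)))
      (.goto fun _ => i (some (Sum.inr d.entry))))
      (Sum.elim (c.code (fun l => i (some (Sum.inl l))) x)
        (d.code (fun l => i (some (Sum.inr l))) x))
  | .loop k p c, i, x, l =>
    Option.elim l (.pop k (fun v b => (b, v.2))
      (.branch (fun v => p v.1) (.goto fun _ => i (some c.entry)) (.goto fun _ => x)))
      (c.code (fun l => i (some l)) (i none))

variable [DecidableEq K]

/-- The state after the stack `k` has been popped. -/
def popped (k : K) (s : State K) : State K :=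
  (((s.2 k).head?, s.1.2), update s.2 k (s.2 k).tail)

/-- `Exec c s s' t`: from the state `s`, the program `c` reaches the state `s'` in `t` steps. -/
inductive Exec : Cmd K → State K → State K → ℕ → Prop
  | push (k f s) : Exec (.push k f) s (s.1, update s.2 k (f s.1 :: s.2 k)) 1
  | pop (k s) : Exec (.pop k) s (popped k s) 1
  | load (f s) : Exec (.load f) s (f s.1, s.2) 1
  | seq {c d s s' s'' t t'} (h : Exec c s s' t) (h' : Exec d s' s'' t') :
      Exec (.seq c d) s s'' (t + t')
  | ite_true {p c d s s' t} (hp : p s.1 = true) (h : Exec c s s' t) :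
      Exec (.ite p c d) s s' (1 + t)
  | ite_false {p c d s s' t} (hp : p s.1 = false) (h : Exec d s s' t) :
      Exec (.ite p c d) s s' (1 + t)
  | loop_done {k p c s} (hp : p (s.2 k).head? = false) : Exec (.loop k p c) s (popped k s) 1
  | loop_step {k p c s s' s'' t t'} (hp : p (s.2 k).head? = true) (h : Exec c (popped k s) s' t)
      (h' : Exec (.loop k p c) s' s'' t') : Exec (.loop k p c) s s'' (1 + (t + t'))

/-- Formulated for a program sitting inside a larger machine: `i` places its labels, `x` is where
control goes afterwards. The induction can then treat subprograms, whose exit label is the entry of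
what follows. -/
theorem Exec.iterate_step {Λ : Type} {m : Λ → TM2.Stmt (fun _ : K => Bool) Λ Regs} {c : Cmd K}
    {s s' : State K} {t : ℕ} (h : Exec c s s' t) (i : c.Label → Λ) (x : Λ)
    (hm : ∀ l, m (i l) = c.code i x l) :
    (flip bind (TM2.step m))^[t] (some ⟨some (i c.entry), s.1, s.2⟩) =
      some ⟨some x, s'.1, s'.2⟩ := by
  induction h generalizing x with
  | push k f s => simp [flip, hm, Cmd.code]
  | pop k s => simp [flip, hm, Cmd.code, popped]
  | load f s => simp [flip, hm, Cmd.code]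
  | @seq c d s s' s'' t t' h h' ih ih' =>
    rw [add_comm t, iterate_add_apply]
    erw [ih (fun l => i (Sum.inl l)) (i (Sum.inr d.entry)) fun l => hm (Sum.inl l)]
    exact ih' _ _ fun l => hm (Sum.inr l)
  | @ite_true p c d s s' t hp h ih =>
    rw [add_comm 1, iterate_add_apply]
    have : (flip bind (TM2.step m))^[1] (some ⟨some (i (Cmd.ite p c d).entry), s.1, s.2⟩) =
        some ⟨some (i (some (Sum.inl c.entry))), s.1, s.2⟩ := by
      simp only [iterate_one, flip, Option.bind_eq_bind, Option.bind_some, Cmd.entry, TM2.step]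
      rw [hm none]
      simp [Cmd.code, hp]
    rw [this]
    exact ih (fun l => i (some (Sum.inl l))) x fun l => hm (some (Sum.inl l))
  | @ite_false p c d s s' t hp h ih =>
    rw [add_comm 1, iterate_add_apply]
    have : (flip bind (TM2.step m))^[1] (some ⟨some (i (Cmd.ite p c d).entry), s.1, s.2⟩) =
        some ⟨some (i (some (Sum.inr d.entry))), s.1, s.2⟩ := by
      simp only [iterate_one, flip, Option.bind_eq_bind, Option.bind_some, Cmd.entry, TM2.step]
      rw [hm none]
      simp [Cmd.code, hp]
    rw [this]
    exact ih (fun l => i (some (Sum.inr l))) x fun l => hm (some (Sum.inr l))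
  | @loop_done k p c s hp =>
    simp only [iterate_one, flip, Option.bind_eq_bind, Option.bind_some, Cmd.entry, TM2.step]
    rw [hm none]
    simp [Cmd.code, hp, popped]
  | @loop_step k p c s s' s'' t t' hp h h' ih ih' =>
    rw [add_comm 1, iterate_add_apply, add_comm t, iterate_add_apply]
    have : (flip bind (TM2.step m))^[1] (some ⟨some (i (Cmd.loop k p c).entry), s.1, s.2⟩) =
        some ⟨some (i (some c.entry)), (popped k s).1, (popped k s).2⟩ := by
      simp only [iterate_one, flip, Option.bind_eq_bind, Option.bind_some, Cmd.entry, TM2.step]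
      rw [hm none]
      simp [Cmd.code, hp, popped]
    rw [this]
    erw [ih (fun l => i (some l)) (i none) fun l => hm (some l)]
    exact ih' i x hm

/-- The machine that runs a program and then halts with initial registers. -/
noncomputable def Cmd.machine [Fintype K] (c : Cmd K) (k₀ k₁ : K) : FinTM2 where
  K := K
  k₀ := k₀
  k₁ := k₁
  Γ _ := Bool
  Λ := Option c.Label
  main := some c.entry
  ΛFin := Fintype.ofFinite _
  σ := Regs
  initialState := (none, false)
  m l := l.elim (.load (fun _ => (none, false)) .halt) (c.code some none)

/-- A function computed by a stack program within a polynomial number of steps is computable in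
polynomial time. -/
theorem nonempty_computableInPolyTime [Fintype K] {α β : Type} (ea : α → List Bool)
    (eb : β → List Bool) (f : α → β) (c : Cmd K) (k₀ k₁ : K) (b : Polynomial ℕ)
    (h : ∀ a, ∃ v, ∃ t ≤ b.eval (ea a).length,
      Exec c ((none, false), update (fun _ => []) k₀ (ea a))
        (v, update (fun _ => []) k₁ (eb (f a))) t) :
    Nonempty (TM2ComputableInPolyTime ea eb f) := by
  choose v t ht hexec using h
  refine ⟨{
    tm := c.machine k₀ k₁
    inputAlphabet := Equiv.refl Bool
    outputAlphabet := Equiv.refl Bool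
    -- The additional step is the final statement, which resets the registers and halts.
    time := b + 1
    outputsFun := fun a => {
      steps := 1 + t a
      evals_in_steps := ?_
      steps_le_m := ?_ } }⟩
  · have h0 : initList (c.machine k₀ k₁) (List.map (Equiv.refl Bool).invFun (ea a)) =
        ⟨some (some c.entry), (none, false), update (fun _ => []) k₀ (ea a)⟩ := by
      simp only [initList]
      congr 1
      refine funext fun (k : K) => ?_
      by_cases hk : k = k₀
      · subst hk
        refine (dif_pos rfl).trans (Eq.trans ?_ (update_self k (ea a) fun _ => ([] : List Bool)).symm)
        exact List.map_id _
      · exact (dif_neg hk).trans (update_of_ne hk _ fun _ => ([] : List Bool)).symm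
    have h1 : haltList (c.machine k₀ k₁) (List.map (Equiv.refl Bool).invFun (eb (f a))) =
        ⟨none, (none, false), update (fun _ => []) k₁ (eb (f a))⟩ := by
      simp only [haltList]
      congr 1
      refine funext fun (k : K) => ?_
      by_cases hk : k = k₁
      · subst hk
        refine (dif_pos rfl).trans (Eq.trans ?_ (update_self k (eb (f a)) fun _ => ([] : List Bool)).symm)
        exact List.map_id _
      · exact (dif_neg hk).trans (update_of_ne hk _ fun _ => ([] : List Bool)).symm
    rw [iterate_add_apply]
    simp only [Option.map_some]
    erw [h0, h1, (hexec a).iterate_step (m := (c.machine k₀ k₁).m) some none fun l => rfl]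
    rfl
  · rw [Polynomial.eval_add, Polynomial.eval_one, add_comm]
    exact Nat.add_le_add_right (ht a) 1

/-! ### Rules for deriving the effect and the running time of programs. -/

section Rules

/-- The stacks of the programs below. -/
inductive Stack
  | inp | num | num2 | cnt | cnt2 | dart | dart2 | aux | out | src | pre | row
  deriving DecidableEq

instance : Fintype Stack :=
  ⟨{.inp, .num, .num2, .cnt, .cnt2, .dart, .dart2, .aux, .out, .src, .pre, .row},
    fun k => by cases k <;> decide⟩

/-- The contents of the stacks. -/
structure Stacks where
  inp : List Bool := []
  num : List Bool := []
  num2 : List Bool := []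
  cnt : List Bool := []
  cnt2 : List Bool := []
  dart : List Bool := []
  dart2 : List Bool := []
  aux : List Bool := []
  out : List Bool := []
  src : List Bool := []
  pre : List Bool := []
  row : List Bool := []

namespace Stacks

/-- The contents of one stack. -/
def get (S : Stacks) : Stack → List Bool
  | .inp => S.inp
  | .num => S.num
  | .num2 => S.num2
  | .cnt => S.cnt
  | .cnt2 => S.cnt2
  | .dart => S.dart
  | .dart2 => S.dart2
  | .aux => S.aux
  | .out => S.out
  | .src => S.src
  | .pre => S.pre
  | .row => S.row

/-- Change the contents of one stack. -/
def set (S : Stacks) (k : Stack) (l : List Bool) : Stacks :=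
  match k with
  | .inp => { S with inp := l }
  | .num => { S with num := l }
  | .num2 => { S with num2 := l }
  | .cnt => { S with cnt := l }
  | .cnt2 => { S with cnt2 := l }
  | .dart => { S with dart := l }
  | .dart2 => { S with dart2 := l }
  | .aux => { S with aux := l }
  | .out => { S with out := l }
  | .src => { S with src := l }
  | .pre => { S with pre := l }
  | .row => { S with row := l }

/-- Translates the updates of functions in `Exec` to updates of records, which compute by `rfl` and
`simp` on concrete states. -/
theorem update_get (S : Stacks) (k : Stack) (l : List Bool) :
    update S.get k l = (S.set k l).get := by
  funext j
  cases k <;> cases j <;> rfl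

variable {S : Stacks} {x y : Stack} {l l' : List Bool}

@[simp]
theorem get_set_self : (S.set x l).get x = l := by cases x <;> rfl

theorem get_set_of_ne (h : y ≠ x) : (S.set x l).get y = S.get y := by
  rw [← update_get, update_of_ne h]

@[simp]
theorem set_set : (S.set x l).set x l' = S.set x l' := by cases x <;> rfl

@[simp]
theorem set_get : S.set x (S.get x) = S := by cases x <;> rfl

theorem get_injective : Injective get := by
  intro S T h
  have h := congrFun h
  cases S
  cases T
  simp only [Stacks.mk.injEq]
  exact ⟨h .inp, h .num, h .num2, h .cnt, h .cnt2, h .dart, h .dart2, h .aux, h .out, h .src,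
    h .pre, h .row⟩

theorem set_comm (h : x ≠ y) : (S.set x l).set y l' = (S.set y l').set x l :=
  get_injective (by rw [← update_get, ← update_get, ← update_get, ← update_get, update_comm h])

end Stacks

/-- `Runs c s s' b`: from the state `s`, the program `c` reaches in at most `b` steps a state with
second register and stacks `s'`. -/
def Runs (c : Cmd Stack) (s : Regs × Stacks) (s' : Bool × Stacks) (b : ℕ) : Prop :=
  ∃ a, ∃ t ≤ b, Exec c (s.1, s.2.get) ((a, s'.1), s'.2.get) t

/-- The concatenation of a list of programs. -/
def block : List (Cmd Stack) → Cmd Stack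
  | [] => .load id
  | c :: l => .seq c (block l)

namespace Runs

variable {c : Cmd Stack} {cs : List (Cmd Stack)} {s : Regs × Stacks} {v : Regs} {S : Stacks}
  {s' s'' : Bool × Stacks} {b b' : ℕ} {k : Stack} {p : Option Bool → Bool}

theorem mono (h : Runs c s s' b) (hb : b ≤ b') : Runs c s s' b' := by
  obtain ⟨a, t, ht, h⟩ := h
  exact ⟨a, t, ht.trans hb, h⟩

theorem congr (h : Runs c s s' b) (hs : s' = s'') : Runs c s s'' b := hs ▸ h

theorem conseq (hs : s' = s'') (hb : b ≤ b') (h : Runs c s s' b) : Runs c s s'' b' :=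
  (h.congr hs).mono hb

theorem nil {a : Option Bool} {w : Bool} : Runs (block []) ((a, w), S) (w, S) 1 :=
  ⟨a, 1, le_rfl, .load id _⟩

/-- `Runs` forgets the symbol popped last, so the continuation must work for every such symbol. The
rules for single `push`, `pop` and `load` commands below keep track of it instead. -/
theorem cons {w : Bool} (h : Runs c s (w, S) b) (h' : ∀ a, Runs (block cs) ((a, w), S) s'' b') :
    Runs (block (c :: cs)) s s'' (b + b') := by
  obtain ⟨a, t, ht, h⟩ := h
  obtain ⟨a', t', ht', h'⟩ := h' a
  exact ⟨a', t + t', add_le_add ht ht', .seq h h'⟩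

theorem push {f : Regs → Bool} (h : Runs (block cs) (v, S.set k (f v :: S.get k)) s' b) :
    Runs (block (.push k f :: cs)) (v, S) s' (1 + b) := by
  obtain ⟨a, t, ht, h⟩ := h
  refine ⟨a, 1 + t, by omega, .seq (.push k f _) ?_⟩
  dsimp only at h ⊢
  rwa [Stacks.update_get]

theorem pop (h : Runs (block cs) (((S.get k).head?, v.2), S.set k (S.get k).tail) s' b) :
    Runs (block (.pop k :: cs)) (v, S) s' (1 + b) := by
  obtain ⟨a, t, ht, h⟩ := h
  refine ⟨a, 1 + t, by omega, .seq (.pop k _) ?_⟩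
  dsimp only [popped] at h ⊢
  rwa [Stacks.update_get]

theorem load {f : Regs → Regs} (h : Runs (block cs) (f v, S) s' b) :
    Runs (block (.load f :: cs)) (v, S) s' (1 + b) := by
  obtain ⟨a, t, ht, h⟩ := h
  exact ⟨a, 1 + t, by omega, .seq (.load f _) h⟩

theorem ite {p : Regs → Bool} {d : Cmd Stack} (h : Runs (if p v = true then c else d) (v, S) s' b) :
    Runs (.ite p c d) (v, S) s' (1 + b) := by
  obtain ⟨a, t, ht, h⟩ := h
  by_cases hp : p v = true
  · rw [if_pos hp] at h
    exact ⟨a, 1 + t, by omega, .ite_true hp h⟩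
  · rw [if_neg hp] at h
    exact ⟨a, 1 + t, by omega, .ite_false (by simpa using hp) h⟩

/-- A loop that performs one iteration for each element of a list, where `T r g` is the state in
which the elements of `r` remain and `g` has been accumulated. -/
theorem loop_foldl {ι γ : Type*} (T : List ι → γ → Stacks) (f : γ → ι → γ) (P : γ → Prop)
    {w : Bool} (l : List ι) (g : γ) (hg : P g) (hf : ∀ i ∈ l, ∀ g, P g → P (f g i))
    (hp : ∀ i ∈ l, ∀ r g, P g → p ((T (i :: r) g).get k).head? = true)
    (hc : ∀ i ∈ l, ∀ r g, P g → Runs c ((((T (i :: r) g).get k).head?, w),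
      (T (i :: r) g).set k ((T (i :: r) g).get k).tail) (w, T r (f g i)) b)
    (hend : ∀ g, P g → p ((T [] g).get k).head? = false) (a : Option Bool) :
    Runs (.loop k p c) ((a, w), T l g) (w, (T [] (l.foldl f g)).set k
      ((T [] (l.foldl f g)).get k).tail) (l.length * (b + 1) + 1) := by
  induction l generalizing g a with
  | nil =>
    refine ⟨((T [] g).get k).head?, 1, by simp, ?_⟩
    rw [← Stacks.update_get]
    exact .loop_done (hend g hg)
  | cons i l ih =>
    have hi : i ∈ i :: l := List.mem_cons_self
    obtain ⟨a', t, ht, h⟩ := hc i hi l g hg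
    obtain ⟨a'', t', ht', h'⟩ := ih (f g i) (hf i hi g hg)
      (fun j hj => hf j (List.mem_cons_of_mem _ hj)) (fun j hj => hp j (List.mem_cons_of_mem _ hj))
      (fun j hj => hc j (List.mem_cons_of_mem _ hj)) a'
    rw [← Stacks.update_get] at h
    refine ⟨a'', 1 + (t + t'), ?_, .loop_step (hp i hi l g hg) h h'⟩
    rw [List.length_cons, Nat.succ_mul]
    omega

/-- A loop that performs `n` iterations, where `T i` is the state in which `i` iterations
remain. -/
theorem loop_iterate (T : ℕ → Stacks) {w : Bool} (n : ℕ)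
    (hp : ∀ i < n, p ((T (i + 1)).get k).head? = true)
    (hc : ∀ i < n, Runs c ((((T (i + 1)).get k).head?, w),
      (T (i + 1)).set k ((T (i + 1)).get k).tail) (w, T i) b)
    (hend : p ((T 0).get k).head? = false) (a : Option Bool) :
    Runs (.loop k p c) ((a, w), T n) (w, (T 0).set k ((T 0).get k).tail) (n * (b + 1) + 1) := by
  induction n generalizing a with
  | zero =>
    refine ⟨((T 0).get k).head?, 1, by simp, ?_⟩
    rw [← Stacks.update_get]
    exact .loop_done hend
  | succ n ih =>
    have hi : n < n + 1 := n.lt_succ_self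
    obtain ⟨a', t, ht, h⟩ := hc n hi
    obtain ⟨a'', t', ht', h'⟩ := ih (fun j hj => hp j (hj.trans hi))
      (fun j hj => hc j (hj.trans hi)) a'
    rw [← Stacks.update_get] at h
    refine ⟨a'', 1 + (t + t'), ?_, .loop_step (hp n hi) h h'⟩
    rw [Nat.succ_mul]
    omega

end Runs

/-- A function is computable in polynomial time if some program computes it, from the stack `inp` to
the stack `out`, within a polynomial number of steps. -/
theorem nonempty_computableInPolyTime_of_runs {α β : Type} (ea : α → List Bool)
    (eb : β → List Bool) (f : α → β) (c : Cmd Stack) (b : Polynomial ℕ)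
    (h : ∀ a, Runs c ((none, false), { inp := ea a }) (false, { out := eb (f a) })
      (b.eval (ea a).length)) :
    Nonempty (TM2ComputableInPolyTime ea eb f) := by
  refine nonempty_computableInPolyTime ea eb f c .inp .out b fun i => ?_
  obtain ⟨a, t, ht, h⟩ := h i
  refine ⟨(a, false), t, ht, ?_⟩
  convert h using 2
  · funext k
    cases k <;> rfl
  · funext k
    cases k <;> rfl

end Rules

end StackProgram

namespace StackProgram

/-! ### Basic programs for moving, clearing and reading stacks. -/

section Macros

variable {x y : Stack} {S : Stacks} {w : Bool} {rest : List Bool} {j : ℕ}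

theorem unary_append (j : ℕ) (l : List Bool) :
    unary j ++ l = List.replicate j true ++ false :: l := by
  simp [unary]

theorem reverse_unary (j : ℕ) : (unary j).reverse = false :: List.replicate j true := by
  simp [unary]

theorem length_unary (j : ℕ) : (unary j).length = j + 1 := by
  simp [unary]

/-- Move the stack `x` onto the stack `y`. -/
def moveAll (x y : Stack) : Cmd Stack :=
  .loop x Option.isSome (block [.push y fun v => v.1.getD false])

/-- Moving reverses the contents, so data that must keep their order are moved twice. -/
theorem moveAll_runs (hxy : x ≠ y) (a : Option Bool) :
    Runs (moveAll x y) ((a, w), S)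
      (w, (S.set x []).set y ((S.get x).reverse ++ S.get y)) (3 * (S.get x).length + 1) := by
  have hx : ∀ r g, ((S.set x r).set y g).get x = r := fun r g => by
    rw [Stacks.get_set_of_ne hxy, Stacks.get_set_self]
  have hs : ∀ r g r', ((S.set x r).set y g).set x r' = (S.set x r').set y g := fun r g r' => by
    rw [Stacks.set_comm hxy.symm, Stacks.set_set]
  have := Runs.loop_foldl (p := Option.isSome) (k := x) (b := 2) (w := w)
    (c := block [.push y fun v => v.1.getD false])
    (fun r g => (S.set x r).set y g) (fun g i => i :: g) (fun _ => True) (S.get x) (S.get y)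
    trivial (by simp) (by simp [hx]) (fun i _ r g _ => ?_) (by simp [hx]) a
  · rw [List.foldl_flip_cons_eq_append, List.map_id', hx, List.tail_nil, hs, Stacks.set_get, Stacks.set_get]
      at this
    exact this.mono (by omega)
  · refine (Runs.push .nil).congr ?_
    simp [hx, hs]

/-- Empty the stack `x`. -/
def clear (x : Stack) : Cmd Stack :=
  .loop x Option.isSome (block [])

theorem clear_runs (a : Option Bool) :
    Runs (clear x) ((a, w), S) (w, S.set x []) (2 * (S.get x).length + 1) := by
  have := Runs.loop_foldl (p := Option.isSome) (k := x) (b := 1) (w := w) (c := block [])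
    (fun r _ => S.set x r) (fun g _ => g) (fun _ => True) (S.get x) ()
    trivial (by simp) (by simp) (fun i _ r g _ => Runs.nil.congr (by simp)) (by simp) a
  simp only [Stacks.set_get, Stacks.get_set_self, List.tail_nil, Stacks.set_set] at this
  exact this.mono (by omega)

/-- Move a unary number from the stack `x` onto the stack `y`, without its end marker. -/
def readUnary (x y : Stack) : Cmd Stack :=
  .loop x (fun b => b == some true) (block [.push y fun _ => true])

/-- The failing test that ends the loop pops the end marker, so exactly `rest` remains. -/
theorem readUnary_runs (hxy : x ≠ y) (h : S.get x = unary j ++ rest) (a : Option Bool) :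
    Runs (readUnary x y) ((a, w), S)
      (w, (S.set x rest).set y (List.replicate j true ++ S.get y)) (3 * j + 1) := by
  have hx : ∀ r g, ((S.set x r).set y g).get x = r := fun r g => by
    rw [Stacks.get_set_of_ne hxy, Stacks.get_set_self]
  have hs : ∀ r g r', ((S.set x r).set y g).set x r' = (S.set x r').set y g := fun r g r' => by
    rw [Stacks.set_comm hxy.symm, Stacks.set_set]
  have := Runs.loop_foldl (p := fun b => b == some true) (k := x) (b := 2) (w := w)
    (c := block [.push y fun _ => true])
    (fun r g => (S.set x (r ++ false :: rest)).set y g) (fun g i => i :: g) (fun _ => True)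
    (List.replicate j true) (S.get y)
    trivial (by simp) (fun i hi r g _ => ?_) (fun i hi r g _ => ?_) (by simp [hx]) a
  · rw [List.foldl_flip_cons_eq_append, List.map_id', hx, ← unary_append, ← h, Stacks.set_get, Stacks.set_get,
      List.nil_append, List.tail_cons, hs, List.reverse_replicate, List.length_replicate] at this
    exact this.mono (by omega)
  · rw [List.eq_of_mem_replicate hi, hx]
    rfl
  · rw [List.eq_of_mem_replicate hi]
    refine (Runs.push .nil).congr ?_
    simp [hx, hs]

/-- Move a unary number from the stack `x` onto the stack `y`. -/
def moveField (x y : Stack) : Cmd Stack :=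
  block [readUnary x y, .push y fun _ => false]

theorem moveField_runs (hxy : x ≠ y) (h : S.get x = unary j ++ rest) (a : Option Bool) :
    Runs (moveField x y) ((a, w), S)
      (w, (S.set x rest).set y ((unary j).reverse ++ S.get y)) (3 * j + 3) := by
  refine Runs.conseq ?_ (by omega) (.cons (readUnary_runs hxy h a) fun a => .push .nil)
  simp [reverse_unary]

/-- Remove a unary number from the stack `x`. -/
def skipField (x : Stack) : Cmd Stack :=
  .loop x (fun b => b == some true) (block [])

theorem skipField_runs (h : S.get x = unary j ++ rest) (a : Option Bool) :
    Runs (skipField x) ((a, w), S) (w, S.set x rest) (2 * j + 1) := by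
  have := Runs.loop_iterate (p := fun b => b == some true) (k := x) (b := 1) (w := w)
    (c := block []) (fun i => S.set x (List.replicate i true ++ false :: rest)) j
    (by simp [List.replicate_succ])
    (fun i _ => Runs.nil.congr (by simp [List.replicate_succ])) (by simp) a
  rw [← unary_append, ← h, Stacks.set_get] at this
  refine (this.congr ?_).mono (by omega)
  simp

end Macros

/-! ### Parsing the encoded graph. -/

section ReadGraph

/-- The code of the edges of an embedded graph: for each edge, the tails of its two darts and the
darts that follow them, in the order in which they are written. -/
abbrev EdgeCode : Type := ℕ × ℕ × ℕ × ℕ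

/-- The bit string for the code of an edge. -/
def encodeEdge (e : EdgeCode) : List Bool :=
  unary e.1 ++ (unary e.2.1 ++ (unary e.2.2.1 ++ unary e.2.2.2))

/-- Split the description of an embedded graph from the rest of the input. -/
def readGraph : Cmd Stack :=
  block [readUnary .inp .num, readUnary .inp .cnt,
    .loop .cnt Option.isSome (block [moveField .inp .dart, moveField .inp .dart,
      moveField .inp .dart, moveField .inp .dart, .push .cnt2 fun _ => true]),
    moveAll .dart .dart2]

/-- Numbers in unary are bounded by the length of the input; the 4 counts end markers. All time
bounds use this. -/
theorem length_encodeEdge_le {e : EdgeCode} {l : List EdgeCode} (h : e ∈ l) :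
    e.1 + e.2.1 + e.2.2.1 + e.2.2.2 + 4 ≤ (l.flatMap encodeEdge).length := by
  have h1 : (encodeEdge e).length ≤ (l.flatMap encodeEdge).length := by
    rw [List.length_flatMap]
    exact List.single_le_sum (by simp) _ (List.mem_map_of_mem h)
  refine le_trans ?_ h1
  simp only [encodeEdge, List.length_append, length_unary]
  omega

theorem readGraph_runs (n : ℕ) (l : List EdgeCode) (rest : List Bool) {w : Bool}
    (a : Option Bool) :
    Runs readGraph
      ((a, w), { inp := unary n ++ (unary l.length ++ (l.flatMap encodeEdge ++ rest)) })
      (w, { inp := rest, num := List.replicate n true, cnt2 := List.replicate l.length true,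
            dart2 := l.flatMap encodeEdge })
      (3 * n + 3 * l.length + l.length * (3 * (l.flatMap encodeEdge).length + 3) +
        3 * (l.flatMap encodeEdge).length + 5) := by
  have key := Runs.loop_foldl (p := Option.isSome) (k := .cnt)
    (b := 3 * (l.flatMap encodeEdge).length + 2) (w := w)
    (c := block [moveField .inp .dart, moveField .inp .dart,
      moveField .inp .dart, moveField .inp .dart, .push .cnt2 fun _ => true])
    (fun r (g : List Bool × List Bool) => {
      inp := r.flatMap encodeEdge ++ rest
      num := List.replicate n true
      cnt := List.replicate r.length true
      dart := g.1
      cnt2 := g.2 })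
    (fun g e => ((encodeEdge e).reverse ++ g.1, true :: g.2)) (fun _ => True) l ([], []) trivial
    (by simp) (by intros; rfl) (fun e he r g _ => ?_) (by intros; rfl)
  · have hfold : ∀ (l : List EdgeCode) (g : List Bool × List Bool),
        l.foldl (fun g e => ((encodeEdge e).reverse ++ g.1, true :: g.2)) g =
          ((l.flatMap encodeEdge).reverse ++ g.1, List.replicate l.length true ++ g.2) := by
      intro l
      induction l with
      | nil => simp
      | cons e l ih =>
        intro g
        rw [List.foldl_cons, ih]
        simp [List.replicate_succ']
    rw [hfold] at key
    refine Runs.conseq ?_ ?_ (.cons (readUnary_runs (by decide) rfl a) fun a =>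
      .cons ((readUnary_runs (j := l.length) (rest := l.flatMap encodeEdge ++ rest)
        (by decide) rfl a).congr (by simp [Stacks.set, Stacks.get])) fun a => .cons (key a) fun a => .cons (moveAll_runs (by decide) a)
        fun a => .nil)
    · simp [Stacks.set, Stacks.get]
    · simp only [Stacks.set, Stacks.get, List.append_nil, List.length_reverse]
      ring_nf
      omega
  · refine Runs.conseq ?_ ?_ (.cons (moveField_runs (j := e.1) (rest := unary e.2.1 ++ (unary e.2.2.1 ++
      (unary e.2.2.2 ++ (r.flatMap encodeEdge ++ rest)))) (by decide) ?_ _) fun a =>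
      .cons (moveField_runs (by decide) rfl a) fun a =>
      .cons (moveField_runs (by decide) rfl a) fun a =>
      .cons (moveField_runs (by decide) rfl a) fun a => .push .nil)
    · simp [Stacks.get, Stacks.set, encodeEdge]
    · have := length_encodeEdge_le he
      omega
    · simp [Stacks.get, Stacks.set, encodeEdge]

end ReadGraph

end StackProgram

namespace StackProgram

/-! ### Random access into a row or matrix stored on a stack. -/

section Advance

variable {S : Stacks} {w : Bool} {rest l₁ l₂ : List Bool} {n : ℕ}

theorem foldl_cons_true_cons (l : List Bool) (g : List Bool × List Bool) :
    l.foldl (fun g i => (true :: g.1, i :: g.2)) g =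
      (List.replicate l.length true ++ g.1, l.reverse ++ g.2) := by
  induction l generalizing g with
  | nil => rfl
  | cons i l ih =>
    rw [List.foldl_cons, ih]
    simp [List.replicate_succ']

/-- Move as many symbols from `row` to `aux` as the unary number on `dart2` says, and move this
number to `dart`, without its end marker. -/
def advance : Cmd Stack :=
  .loop .dart2 (fun b => b == some true)
    (block [.push .dart fun _ => true, .pop .row, .push .aux fun v => v.1.getD false])

theorem advance_runs (S : Stacks) (a : Option Bool) :
    Runs advance
      ((a, w), { S with dart2 := unary l₁.length ++ rest, row := l₁ ++ l₂ })
      (w, { S with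
        dart := List.replicate l₁.length true ++ S.dart
        dart2 := rest
        row := l₂
        aux := l₁.reverse ++ S.aux }) (5 * l₁.length + 1) := by
  have := Runs.loop_foldl (p := fun b => b == some true) (k := .dart2) (b := 4) (w := w)
    (c := block [.push .dart fun _ => true, .pop .row, .push .aux fun v => v.1.getD false])
    (fun r (g : List Bool × List Bool) => { S with
      dart := g.1
      dart2 := unary r.length ++ rest
      row := r ++ l₂
      aux := g.2 })
    (fun g i => (true :: g.1, i :: g.2)) (fun _ => True) l₁ (S.dart, S.aux) trivial
    (by simp) (by intros; rfl) (fun i _ r g _ => ?_) (by intros; rfl) a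
  · rw [foldl_cons_true_cons] at this
    exact this.mono (by omega)
  · exact (Runs.push (.pop (.push .nil))).congr rfl

/-- Move one row of the matrix from `row` to `aux`. -/
def advanceRow : Cmd Stack :=
  block [.loop .num Option.isSome
    (block [.push .num2 fun _ => true, .pop .row, .push .aux fun v => v.1.getD false]),
    moveAll .num2 .num]

theorem advanceRow_runs (S : Stacks) (a : Option Bool) :
    Runs advanceRow
      ((a, w), { S with num := List.replicate l₁.length true, num2 := [], row := l₁ ++ l₂ })
      (w, { S with
        num := List.replicate l₁.length true
        num2 := []
        row := l₂
        aux := l₁.reverse ++ S.aux }) (8 * l₁.length + 3) := by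
  have := Runs.loop_foldl (p := Option.isSome) (k := .num) (b := 4) (w := w)
    (c := block [.push .num2 fun _ => true, .pop .row, .push .aux fun v => v.1.getD false])
    (fun r (g : List Bool × List Bool) => { S with
      num := List.replicate r.length true
      num2 := g.1
      row := r ++ l₂
      aux := g.2 })
    (fun g i => (true :: g.1, i :: g.2)) (fun _ => True) l₁ ([], S.aux) trivial
    (by simp) (by intros; rfl) (fun i _ r g _ => ?_) (by intros; rfl) a
  · rw [foldl_cons_true_cons] at this
    refine Runs.conseq ?_ ?_ (.cons this fun a => .cons (moveAll_runs (by decide) a) fun a => .nil)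
    · simp [Stacks.set, Stacks.get]
    · simp [Stacks.set, Stacks.get]
      omega
  · exact (Runs.push (.pop (.push .nil))).congr rfl

end Advance

/-! ### The program for `D ∘ cut`. -/

section DualCut

variable {rest : List Bool} {n : ℕ} {R : List Bool}

/-- Look up whether the ends of the next edge are in the same block, and write the negation. -/
def cutStep : Cmd Stack :=
  block [.loop .dart2 (fun b => b == some true) advanceRow, skipField .dart2, advance, clear .dart,
    .pop .row, .push .row fun v => v.1.getD false, .load fun v => (none, !v.1.getD false),
    moveAll .aux .row, skipField .dart2, .push .pre fun v => v.2, .load fun _ => (none, false)]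

/-- The stacks while the edges are processed. -/
def cutState (n : ℕ) (cnt2 dart dart2 aux pre row : List Bool) : Stacks where
  num := List.replicate n true
  cnt2 := cnt2
  dart := dart
  dart2 := dart2
  aux := aux
  pre := pre
  row := row

/-- The matrix is stored row by row, so the entry for the two tails of `e` is found by skipping
`e.1` rows and then `e.2.2.1` symbols. The skipped prefix waits in reverse on `aux`, and moving it
back restores `R`. -/
theorem cutStep_runs (e : EdgeCode) (c pre : List Bool)
    (h : e.1 * n + e.2.2.1 < R.length) (a : Option Bool) :
    Runs cutStep ((a, false), cutState n c [] (encodeEdge e ++ rest) [] pre R)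
      (false, cutState n c [] rest [] ((!R.getD (e.1 * n + e.2.2.1) false) :: pre) R)
      (e.1 * (8 * n + 4) + 2 * (e.2.1 + e.2.2.2) + 7 * e.2.2.1 + 3 * R.length + 15) := by
  obtain ⟨t, x, u, y⟩ := e
  dsimp only at h ⊢
  have htn : ∀ j ≤ t, j * n ≤ R.length := fun j hj =>
    ((Nat.mul_le_mul_right n hj).trans (Nat.le_add_right _ _)).trans h.le
  have h1 : ∀ a, Runs (.loop .dart2 (fun b => b == some true) advanceRow)
      ((a, false), cutState n c [] (encodeEdge (t, x, u, y) ++ rest) [] pre R)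
      (false, cutState n c [] (unary x ++ (unary u ++ (unary y ++ rest)))
        (R.take (t * n)).reverse pre (R.drop (t * n))) (t * (8 * n + 4) + 1) := by
    intro a
    have := Runs.loop_iterate (p := fun b => b == some true) (k := .dart2) (c := advanceRow)
      (b := 8 * n + 3) (w := false)
      (fun i => cutState n c [] (unary i ++ (unary x ++ (unary u ++ (unary y ++ rest))))
        (R.take ((t - i) * n)).reverse pre (R.drop ((t - i) * n))) t
      (fun _ _ => rfl) (fun i hi => ?_) rfl a
    · simp only [Nat.sub_self, Nat.zero_mul, List.take_zero, List.drop_zero, List.reverse_nil,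
        Nat.sub_zero] at this
      simp only [encodeEdge, List.append_assoc]
      exact this
    · obtain ⟨j, rfl⟩ : ∃ j, t = j + (i + 1) := ⟨t - (i + 1), by omega⟩
      have hlen : ((R.drop (j * n)).take n).length = n := by
        have := htn (j + 1) (by omega)
        rw [List.length_take, List.length_drop]
        rw [Nat.succ_mul] at this
        omega
      have := advanceRow_runs (w := false) (l₁ := (R.drop (j * n)).take n)
        (l₂ := (R.drop (j * n)).drop n)
        (cutState n c [] (unary i ++ (unary x ++ (unary u ++ (unary y ++ rest))))
          (R.take (j * n)).reverse pre []) (some true)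
      rw [List.take_append_drop, hlen, List.drop_drop, ← Nat.succ_mul] at this
      rw [show j + (i + 1) - (i + 1) = j by omega, show j + (i + 1) - i = j + 1 by omega]
      refine Runs.congr this ?_
      simp only [cutState, Nat.succ_mul, List.take_add, List.reverse_append]
  have h2 : ∀ a, Runs (skipField .dart2)
      ((a, false), cutState n c [] (unary x ++ (unary u ++ (unary y ++ rest)))
        (R.take (t * n)).reverse pre (R.drop (t * n)))
      (false, cutState n c [] (unary u ++ (unary y ++ rest))
        (R.take (t * n)).reverse pre (R.drop (t * n))) (2 * x + 1) :=
    fun a => skipField_runs rfl a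
  have hlen : ((R.drop (t * n)).take u).length = u := by
    rw [List.length_take, List.length_drop]
    omega
  have h3 : ∀ a, Runs advance
      ((a, false), cutState n c [] (unary u ++ (unary y ++ rest))
        (R.take (t * n)).reverse pre (R.drop (t * n)))
      (false, cutState n c (List.replicate u true) (unary y ++ rest)
        (R.take (t * n + u)).reverse pre (R.drop (t * n + u))) (5 * u + 1) := by
    intro a
    have := advance_runs (w := false) (rest := unary y ++ rest)
      (l₁ := (R.drop (t * n)).take u) (l₂ := (R.drop (t * n)).drop u)
      (cutState n c [] [] (R.take (t * n)).reverse pre []) a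
    rw [List.take_append_drop, hlen, List.drop_drop] at this
    refine Runs.congr this ?_
    simp [cutState, List.take_add]
  have h4 : ∀ a, Runs (clear .dart)
      ((a, false), cutState n c (List.replicate u true) (unary y ++ rest)
        (R.take (t * n + u)).reverse pre (R.drop (t * n + u)))
      (false, cutState n c [] (unary y ++ rest)
        (R.take (t * n + u)).reverse pre (R.drop (t * n + u))) (2 * u + 1) := by
    intro a
    refine (clear_runs a).mono ?_
    simp [cutState, Stacks.get]
  -- The position is in range, so the pop that follows finds a genuine entry, not the default value.
  have hR : R.drop (t * n + u) = R.getD (t * n + u) false :: R.drop (t * n + u + 1) := by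
    rw [List.getD_eq_getElem _ _ h]
    exact List.drop_eq_getElem_cons h
  have h5 : ∀ a v, Runs (moveAll .aux .row)
      ((a, v), cutState n c [] (unary y ++ rest)
        (R.take (t * n + u)).reverse pre (R.drop (t * n + u)))
      (v, cutState n c [] (unary y ++ rest) [] pre R) (3 * R.length + 1) := by
    intro a v
    refine Runs.conseq ?_ ?_ (moveAll_runs (by decide) a)
    · simp [cutState, Stacks.set, Stacks.get]
    · simp [cutState, Stacks.get]
  have h6 : ∀ a v, Runs (block [skipField .dart2, .push .pre fun v => v.2,
      .load fun _ => (none, false)])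
      ((a, v), cutState n c [] (unary y ++ rest) [] pre R)
      (false, cutState n c [] rest [] (v :: pre) R) (2 * y + 4) :=
    fun a v => Runs.mono (.cons (skipField_runs rfl a) fun a => .push (.load .nil)) (by omega)
  rw [hR] at h3 h4 h5
  exact Runs.mono (.cons (h1 a) fun a => .cons (h2 a) fun a => .cons (h3 a) fun a =>
    .cons (h4 a) fun a => .pop (.push (.load (.cons (h5 none _) fun a => h6 a _)))) (by omega)

end DualCut

end StackProgram

namespace StackProgram

section DualCut

/-- The program that computes `D ∘ cut`. -/
def dualCutProgram : Cmd Stack :=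
  block [readGraph, moveAll .inp .aux, moveAll .aux .row, .loop .cnt2 Option.isSome cutStep,
    moveAll .pre .out, clear .num, clear .row]

theorem dualCutProgram_runs (n : ℕ) (l : List EdgeCode) (R : List Bool)
    (h : ∀ e ∈ l, e.1 * n + e.2.2.1 < R.length) (a : Option Bool) (L : ℕ)
    (hL : n + l.length + (l.flatMap encodeEdge).length + R.length ≤ L) :
    Runs dualCutProgram
      ((a, false), { inp := unary n ++ (unary l.length ++ (l.flatMap encodeEdge ++ R)) })
      (false, { out := l.map fun e => !R.getD (e.1 * n + e.2.2.1) false }) (60 * (L + 1) ^ 3) := by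
  have key := Runs.loop_foldl (p := Option.isSome) (k := .cnt2) (c := cutStep) (w := false)
    -- The bound of `cutStep_runs` with all of its parameters estimated by `L`.
    (b := 8 * (L * L) + 14 * L + 15)
    (fun r pre => cutState n (List.replicate r.length true) [] (r.flatMap encodeEdge) [] pre R)
    (fun pre e => (!R.getD (e.1 * n + e.2.2.1) false) :: pre) (fun _ => True) l [] trivial
    (by simp) (by intros; rfl) (fun e he r g _ => ?_) (by intros; rfl)
  · rw [List.foldl_flip_cons_eq_append, List.append_nil] at key
    have h1 : ∀ a, Runs (moveAll .inp .aux)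
        ((a, false), { inp := R, num := List.replicate n true,
                       cnt2 := List.replicate l.length true, dart2 := l.flatMap encodeEdge })
        (false, cutState n (List.replicate l.length true) [] (l.flatMap encodeEdge)
          R.reverse [] []) (3 * R.length + 1) := fun a =>
      (moveAll_runs (by decide) a).congr (by simp [cutState, Stacks.set, Stacks.get])
    have h2 : ∀ a, Runs (moveAll .aux .row)
        ((a, false), cutState n (List.replicate l.length true) [] (l.flatMap encodeEdge)
          R.reverse [] [])
        (false, cutState n (List.replicate l.length true) [] (l.flatMap encodeEdge)
          [] [] R) (3 * R.length + 1) := fun a =>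
      Runs.conseq (by simp [cutState, Stacks.set, Stacks.get])
        (by simp [cutState, Stacks.get]) (moveAll_runs (by decide) a)
    have h3 : ∀ a, Runs (block [moveAll .pre .out, clear .num, clear .row])
        ((a, false), cutState n [] [] [] []
          (l.map fun e => !R.getD (e.1 * n + e.2.2.1) false).reverse R)
        (false, { out := l.map fun e => !R.getD (e.1 * n + e.2.2.1) false })
        (3 * l.length + 2 * n + 2 * R.length + 4) := by
      intro a
      refine Runs.conseq ?_ ?_ (.cons (moveAll_runs (by decide) a) fun a =>
        .cons (clear_runs a) fun a => .cons (clear_runs a) fun a => .nil)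
      · simp [cutState, Stacks.set, Stacks.get]
      · simp [cutState, Stacks.set, Stacks.get]
        omega
    refine Runs.mono (.cons (readGraph_runs n l R a) fun a => .cons (h1 a) fun a =>
      .cons (h2 a) fun a => .cons (key a) h3) ?_
    have hl : l.length ≤ L := by omega
    have hf : (l.flatMap encodeEdge).length ≤ L := by omega
    have e1 : l.length * (3 * (l.flatMap encodeEdge).length + 3) ≤ L * (3 * L + 3) := by gcongr
    have e2 : l.length * (8 * (L * L) + 14 * L + 15 + 1) ≤ L * (8 * (L * L) + 14 * L + 15 + 1) := by
      gcongr
    have e3 : 60 * (L + 1) ^ 3 = 60 * (L * L * L) + 180 * (L * L) + 180 * L + 60 := by ring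
    have e4 : L * (3 * L + 3) = 3 * (L * L) + 3 * L := by ring
    have e5 : L * (8 * (L * L) + 14 * L + 15 + 1) = 8 * (L * L * L) + 14 * (L * L) + 16 * L := by
      ring
    omega
  · refine (cutStep_runs e _ g (h e he) _).mono ?_
    have h1 := length_encodeEdge_le he
    have e1 : e.1 * (8 * n + 4) ≤ L * (8 * L + 4) := Nat.mul_le_mul (by omega) (by omega)
    have e2 : L * (8 * L + 4) = 8 * (L * L) + 4 * L := by ring
    omega

end DualCut

end StackProgram

/-! ### Correctness of the program for `D ∘ cut` on encoded inputs. -/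

section Encoding

variable {n m : ℕ} (M : RotationSystem (Fin n) (Fin m))

/-- The list of the codes of the edges. -/
def edgeCodes : List StackProgram.EdgeCode :=
  (List.finRange m).map fun e =>
    (M.tail (e, false), 2 * ((M.next (e, false)).1 : ℕ) + (M.next (e, false)).2.toNat,
      M.tail (e, true), 2 * ((M.next (e, true)).1 : ℕ) + (M.next (e, true)).2.toNat)

theorem length_edgeCodes : (edgeCodes M).length = m := by
  simp [edgeCodes]

theorem encodePlaneGraph_append (l : List Bool) :
    encodePlaneGraph M ++ l = unary n ++ (unary (edgeCodes M).length ++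
      ((edgeCodes M).flatMap StackProgram.encodeEdge ++ l)) := by
  rw [length_edgeCodes]
  simp [encodePlaneGraph, edgeCodes, StackProgram.encodeEdge, List.flatMap_map]

theorem length_flatMap_finRange_map (f : Fin n → Fin n → Bool) :
    ((List.finRange n).flatMap fun v => (List.finRange n).map (f v)).length = n * n := by
  simp [List.length_flatMap]

theorem getD_flatMap_finRange_map (f : Fin n → Fin n → Bool) (v w : Fin n) :
    ((List.finRange n).flatMap fun v => (List.finRange n).map (f v)).getD (v * n + w) false =
      f v w := by
  -- The induction needs an arbitrary list of row indices in place of `List.finRange n`.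
  have key : ∀ (l : List (Fin n)) (i : ℕ) (hi : i < l.length),
      (l.flatMap fun v => (List.finRange n).map (f v)).getD (i * n + w) false = f l[i] w := by
    intro l
    induction l with
    | nil => intro i hi; simp at hi
    | cons x l ih =>
      intro i hi
      rw [List.flatMap_cons]
      cases i with
      | zero =>
        rw [List.getD_append _ _ _ _ (by simp)]
        simp [List.getD]
      | succ i =>
        rw [List.getD_append_right _ _ _ _ (by simp [Nat.succ_mul]; omega)]
        have := ih i (by simpa using hi)
        rw [List.getElem_cons_succ, ← this]
        congr 1
        simp [Nat.succ_mul]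
        omega
  have := key (List.finRange n) v (by simp)
  simpa using this

/-- The encoded matrix records whether two vertices share a block; since the blocks are disjoint and
cover all vertices, negating its entry decides membership in the cut. -/
theorem mem_cut_graph_iff {V E : Type*} (M : RotationSystem V E) {P : Set (Set V)} {k : ℕ}
    (hP : P ∈ connectedPartitions M.graph k) (e : E) :
    e ∈ cut M.graph P ↔ ¬ ∃ A ∈ P, M.tail (e, false) ∈ A ∧ M.tail (e, true) ∈ A := by
  constructor
  · rintro ⟨B, hB, C, hC, hne, u, hu, v, hv, hl⟩ ⟨A, hA, h0, h1⟩
    have key : ∀ z C, C ∈ P → z ∈ A → z ∈ C → C = A := by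
      intro z C hC hzB hzC
      by_contra hCB
      exact Set.disjoint_left.1 (hP.2.1 hC hA hCB) hzC hzB
    obtain ⟨rfl, rfl⟩ | ⟨rfl, rfl⟩ := hl.eq_and_eq_or_eq_and_eq (M.graph_isLink e)
    · exact hne ((key _ B hB h0 hu).trans (key _ C hC h1 hv).symm)
    · exact hne ((key _ B hB h1 hu).trans (key _ C hC h0 hv).symm)
  · intro h
    have hU : ∀ v, v ∈ ⋃₀ P := fun v => hP.2.2.1 ▸ Set.mem_univ v
    obtain ⟨B, hB, h0⟩ := hU (M.tail (e, false))
    obtain ⟨C, hC, h1⟩ := hU (M.tail (e, true))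
    refine ⟨B, hB, C, hC, ?_, _, h0, _, h1, M.graph_isLink e⟩
    rintro rfl
    exact h ⟨B, hB, h0, h1⟩

theorem computableInPolyTime_dualCut :
    Nonempty (Turing.TM2ComputableInPolyTime PartitionInstance.encode
      (fun J : Σ m : ℕ, Set (DualEdge (Fin m)) => encodeDualEdgeSet J.2)
      PartitionInstance.dualCut) := by
  classical
  refine StackProgram.nonempty_computableInPolyTime_of_runs _ _ _ StackProgram.dualCutProgram
    (Polynomial.C 60 * (Polynomial.X + 1) ^ 3) fun I => ?_
  obtain ⟨n, m, k, M, hM, P, hP⟩ := I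
  have hR : encodePartition P = (List.finRange n).flatMap fun v => (List.finRange n).map
      fun w => decide (∃ A ∈ P, v ∈ A ∧ w ∈ A) := by
    simp only [encodePartition, encodeVertexSet]
    congr!
  have hlen : (encodePartition P).length = n * n := by
    rw [hR, length_flatMap_finRange_map]
  have henc := encodePlaneGraph_append M (encodePartition P)
  have := StackProgram.dualCutProgram_runs n (edgeCodes M) (encodePartition P) (fun e he => ?_)
    none (encodePlaneGraph M ++ encodePartition P).length ?_
  · simp only [PartitionInstance.encode, Polynomial.eval_mul, Polynomial.eval_C,
      Polynomial.eval_pow, Polynomial.eval_add, Polynomial.eval_X, Polynomial.eval_one]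
    rw [← henc] at this
    refine this.congr ?_
    congr 2
    simp only [PartitionInstance.dualCut, encodeDualEdgeSet, edgeCodes, List.map_map]
    refine List.map_congr_left fun e _ => ?_
    simp only [Function.comp_apply]
    rw [hR, getD_flatMap_finRange_map, ← decide_not]
    exact decide_eq_decide.2 (mem_cut_graph_iff M hP e).symm
  · simp only [edgeCodes, List.mem_map] at he
    obtain ⟨e, -, rfl⟩ := he
    rw [hlen]
    have h1 := (M.tail (e, false)).2
    have h2 := (M.tail (e, true)).2
    dsimp only
    nlinarith
  · rw [henc]
    simp only [List.length_append, StackProgram.length_unary]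
    omega

end Encoding

namespace StackProgram

/-! ### One relaxation pass over a list of edges. -/

section Pass

variable {rest R D : List Bool} {n : ℕ} {v : Bool}

/-- Read the number `i` from `dart2`, and replace both the second register and the entry `i` of
`row` by their disjunction. -/
def visit : Cmd Stack :=
  block [advance, .push .dart fun _ => false, .pop .row,
    .load fun v => (none, v.2 || v.1.getD false), .push .row fun v => v.2, moveAll .aux .row]

/-- Process all edges on `dart2` once. -/
def pass : Cmd Stack :=
  block [.loop .dart2 Option.isSome (block [.push .dart fun _ => true, visit, visit, visit,
    .load fun _ => (none, false)]), moveAll .dart .dart2]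

/-- The stacks while the edges on `dart2` are processed. -/
def passState (S : Stacks) (dart dart2 aux row : List Bool) : Stacks :=
  { S with dart := dart, dart2 := dart2, aux := aux, row := row }

theorem visit_runs (S : Stacks) {i : ℕ} (hi : i < R.length) (a : Option Bool) :
    Runs visit ((a, v), passState S D (unary i ++ rest) [] R)
      (v || R.getD i false, passState S ((unary i).reverse ++ D) rest []
        (R.set i (v || R.getD i false))) (8 * i + 7) := by
  have hlen : (R.take i).length = i := by
    rw [List.length_take]
    omega
  have h1 : ∀ a, Runs advance ((a, v), passState S D (unary i ++ rest) [] R)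
      (v, passState S (List.replicate i true ++ D) rest (R.take i).reverse (R.drop i))
      (5 * i + 1) := by
    intro a
    have := advance_runs (w := v) (rest := rest) (l₁ := R.take i) (l₂ := R.drop i)
      (passState S D [] [] []) a
    rw [List.take_append_drop, hlen] at this
    refine Runs.congr this ?_
    simp [passState]
  have hR : R.drop i = R.getD i false :: R.drop (i + 1) := by
    rw [List.getD_eq_getElem _ _ hi]
    exact List.drop_eq_getElem_cons hi
  have h2 : ∀ a w D, Runs (block [moveAll .aux .row])
      ((a, w), passState S D rest (R.take i).reverse (w :: R.drop (i + 1)))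
      (w, passState S D rest [] (R.set i w)) (3 * i + 2) := by
    intro a w D
    refine Runs.conseq ?_ ?_ (.cons (moveAll_runs (by decide) a) fun a => .nil)
    · simp [passState, Stacks.set, Stacks.get, List.set_eq_take_append_cons_drop, hi]
    · simp only [passState, Stacks.get, List.length_reverse, hlen]
      omega
  rw [hR] at h1
  rw [reverse_unary]
  exact Runs.mono (.cons (h1 a) fun a => .push (.pop (.load (.push (h2 none _ _))))) (by omega)

/-- The effect on a row of processing an edge with ends `e.1` and `e.2`. -/
def edgeStep (R : List Bool) (e : ℕ × ℕ) : List Bool :=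
  let v₁ := R.getD e.1 false
  let R₁ := R.set e.1 v₁
  let v₂ := v₁ || R₁.getD e.2 false
  let R₂ := R₁.set e.2 v₂
  R₂.set e.1 (v₂ || R₂.getD e.1 false)

/-- The bit string for an edge, given by its ends, that `pass` processes. -/
def encodeEnds (e : ℕ × ℕ) : List Bool :=
  true :: (unary e.1 ++ (unary e.2 ++ unary e.1))

theorem length_edgeStep (R : List Bool) (e : ℕ × ℕ) : (edgeStep R e).length = R.length := by
  simp [edgeStep]

theorem length_flatMap_encodeEnds_le (W : List (ℕ × ℕ)) (hW : ∀ e ∈ W, e.1 < n ∧ e.2 < n) :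
    (W.flatMap encodeEnds).length ≤ W.length * (3 * n + 4) := by
  induction W with
  | nil => simp
  | cons e W ih =>
    have h1 := ih fun e he => hW e (List.mem_cons_of_mem _ he)
    have h2 := hW e List.mem_cons_self
    rw [List.flatMap_cons, List.length_append, List.length_cons, Nat.succ_mul]
    simp only [encodeEnds, List.length_cons, List.length_append, length_unary]
    omega

/-- The leading `true` of each edge is what the test of the loop consumes, so the numbers stay
intact. The invariant is the length of the row, which keeps every index in range. -/
theorem pass_runs (S : Stacks) (W : List (ℕ × ℕ)) (hW : ∀ e ∈ W, e.1 < n ∧ e.2 < n)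
    (hR : R.length = n) (a : Option Bool) :
    Runs pass ((a, false), passState S [] (W.flatMap encodeEnds) [] R)
      (false, passState S [] (W.flatMap encodeEnds) [] (W.foldl edgeStep R))
      (W.length * (33 * n + 37) + 3) := by
  have key := Runs.loop_foldl (p := Option.isSome) (k := .dart2) (w := false)
    (c := block [.push .dart fun _ => true, visit, visit, visit, .load fun _ => (none, false)])
    (b := 24 * n + 24)
    (fun r (g : List Bool × List Bool) => passState S g.1 (r.flatMap encodeEnds) [] g.2)
    (fun g e => ((encodeEnds e).reverse ++ g.1, edgeStep g.2 e)) (fun g => g.2.length = n)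
    W ([], R) hR (fun e _ g hg => by rw [length_edgeStep, hg]) (by intros; rfl)
    (fun e he r g hg => ?_) (by intros; rfl)
  · have hfold : ∀ (W : List (ℕ × ℕ)) (g : List Bool × List Bool),
        W.foldl (fun g e => ((encodeEnds e).reverse ++ g.1, edgeStep g.2 e)) g =
          ((W.flatMap encodeEnds).reverse ++ g.1, W.foldl edgeStep g.2) := by
      intro W
      induction W with
      | nil => simp
      | cons e W ih =>
        intro g
        rw [List.foldl_cons, ih]
        simp
    rw [hfold] at key
    refine Runs.conseq ?_ ?_ (.cons (key a) fun a => .cons (moveAll_runs (by decide) a)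
      fun a => .nil)
    · simp [passState, Stacks.set, Stacks.get]
    · have := length_flatMap_encodeEnds_le W hW
      have e1 : W.length * (24 * n + 24 + 1) + 3 * (W.length * (3 * n + 4)) =
        W.length * (33 * n + 37) := by ring
      simp only [passState, Stacks.set, Stacks.get, List.length_reverse, List.append_nil]
      omega
  · obtain ⟨h1, h2⟩ := hW e he
    have hg1 : e.1 < g.2.length := by omega
    have hg2 : e.2 < g.2.length := by omega
    have hd : (e :: r).flatMap encodeEnds = true :: (unary e.1 ++ (unary e.2 ++
        (unary e.1 ++ r.flatMap encodeEnds))) := by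
      simp [encodeEnds]
    rw [hd]
    refine Runs.conseq ?_ ?_ (.push (.cons
      (visit_runs (R := g.2) (D := true :: g.1) (v := false) (i := e.1)
        (rest := unary e.2 ++ (unary e.1 ++ r.flatMap encodeEnds)) S hg1 _) fun a => .cons
      (visit_runs S (by simpa using hg2) a) fun a => .cons
      (visit_runs S (by simpa using hg1) a) fun a => .load .nil))
    · simp [passState, edgeStep, encodeEnds]
    · omega

end Pass

end StackProgram

namespace StackProgram

/-! ### Computing one row of the reachability matrix. -/

section Source

variable {n : ℕ} {v : Bool}

/-- Push one `false` onto `row` for each symbol on `x`. -/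
def fill (x : Stack) : Cmd Stack :=
  block [.loop x Option.isSome (block [.push .aux fun _ => true, .push .row fun _ => false]),
    moveAll .aux x]

theorem fill_pre_runs (S : Stacks) (j : ℕ) (a : Option Bool) :
    Runs (fill .pre) ((a, v), { S with aux := [], pre := List.replicate j true })
      (v, { S with
        aux := []
        pre := List.replicate j true
        row := List.replicate j false ++ S.row }) (7 * j + 3) := by
  have := Runs.loop_foldl (p := Option.isSome) (k := .pre) (w := v)
    (c := block [.push .aux fun _ => true, .push .row fun _ => false]) (b := 3)
    (fun r (g : List Bool × List Bool) => { S with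
      aux := g.1, pre := List.replicate r.length true, row := g.2 })
    (fun g i => (true :: g.1, i :: g.2)) (fun _ => True) (List.replicate j false) ([], S.row)
    trivial (by simp) (by intros; rfl) (fun i hi r g _ => ?_) (by intros; rfl) a
  · rw [foldl_cons_true_cons, List.length_replicate] at this
    refine Runs.conseq ?_ ?_ (.cons this fun a => .cons (moveAll_runs (by decide) a) fun a => .nil)
    · simp [Stacks.set, Stacks.get]
    · simp [Stacks.set, Stacks.get]
      omega
  · rw [List.eq_of_mem_replicate hi]
    exact (Runs.push (.push .nil)).congr rfl

theorem fill_src_runs (S : Stacks) (j : ℕ) (a : Option Bool) :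
    Runs (fill .src) ((a, v), { S with aux := [], src := List.replicate j true })
      (v, { S with
        aux := []
        src := List.replicate j true
        row := List.replicate j false ++ S.row }) (7 * j + 3) := by
  have := Runs.loop_foldl (p := Option.isSome) (k := .src) (w := v)
    (c := block [.push .aux fun _ => true, .push .row fun _ => false]) (b := 3)
    (fun r (g : List Bool × List Bool) => { S with
      aux := g.1, src := List.replicate r.length true, row := g.2 })
    (fun g i => (true :: g.1, i :: g.2)) (fun _ => True) (List.replicate j false) ([], S.row)
    trivial (by simp) (by intros; rfl) (fun i hi r g _ => ?_) (by intros; rfl) a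
  · rw [foldl_cons_true_cons, List.length_replicate] at this
    refine Runs.conseq ?_ ?_ (.cons this fun a => .cons (moveAll_runs (by decide) a) fun a => .nil)
    · simp [Stacks.set, Stacks.get]
    · simp [Stacks.set, Stacks.get]
      omega
  · rw [List.eq_of_mem_replicate hi]
    exact (Runs.push (.push .nil)).congr rfl

/-- The row of the identity matrix with index `i`. -/
def oneHot (n i : ℕ) : List Bool :=
  List.replicate i false ++ true :: List.replicate (n - (i + 1)) false

theorem length_oneHot {i : ℕ} (hi : i < n) : (oneHot n i).length = n := by
  simp [oneHot]
  omega

theorem length_foldl_edgeStep (W : List (ℕ × ℕ)) (R : List Bool) :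
    (W.foldl edgeStep R).length = R.length := by
  induction W generalizing R with
  | nil => rfl
  | cons e W ih => rw [List.foldl_cons, ih, length_edgeStep]

theorem length_iterate_foldl_edgeStep (W : List (ℕ × ℕ)) (R : List Bool) (j : ℕ) :
    ((fun R => W.foldl edgeStep R)^[j] R).length = R.length := by
  induction j with
  | zero => rfl
  | succ j ih => rw [Function.iterate_succ_apply', length_foldl_edgeStep, ih]

/-- The row of the reachability matrix with index `i`. -/
def reachRow (W : List (ℕ × ℕ)) (n i : ℕ) : List Bool :=
  (fun R => W.foldl edgeStep R)^[n] (oneHot n i)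

/-- Compute one row of the reachability matrix. -/
def sourceStep : Cmd Stack :=
  block [fill .pre, .push .row fun _ => true, fill .src, .push .pre fun _ => true,
    .loop .num Option.isSome (block [.push .num2 fun _ => true, pass]), moveAll .num2 .num,
    moveAll .row .aux, moveAll .aux .out]

/-- The stacks while the rows of the reachability matrix are computed. -/
def sourceState (W : List (ℕ × ℕ)) (num num2 src pre out row : List Bool) : Stacks where
  num := num
  num2 := num2
  dart2 := W.flatMap encodeEnds
  src := src
  pre := pre
  out := out
  row := row

/-- The stacks `src` and `pre` hold the numbers of vertices before and after `i`, from which the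
unit vector is built back to front. The finished row is put on top of `out`, so treating `i` in
decreasing order leaves the rows in increasing order. -/
theorem sourceStep_runs (W : List (ℕ × ℕ)) (hW : ∀ e ∈ W, e.1 < n ∧ e.2 < n) {i : ℕ} (hi : i < n)
    (out : List Bool) (a : Option Bool) :
    Runs sourceStep ((a, false), sourceState W (List.replicate n true) []
        (List.replicate i true) (List.replicate (n - (i + 1)) true) out [])
      (false, sourceState W (List.replicate n true) []
        (List.replicate i true) (List.replicate (n - i) true) (reachRow W n i ++ out) [])
      (n * (W.length * (33 * n + 37) + 6) + 23 * n + 13) := by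
  have h1 : ∀ a, Runs (fill .pre) ((a, false), sourceState W (List.replicate n true) []
        (List.replicate i true) (List.replicate (n - (i + 1)) true) out [])
      (false, sourceState W (List.replicate n true) [] (List.replicate i true)
        (List.replicate (n - (i + 1)) true) out (List.replicate (n - (i + 1)) false))
      (7 * n + 3) := fun a =>
    Runs.conseq (by simp [sourceState]) (by omega) (fill_pre_runs (sourceState W
      (List.replicate n true) [] (List.replicate i true) [] out []) (n - (i + 1)) a)
  have h2 : ∀ a, Runs (fill .src) ((a, false), sourceState W (List.replicate n true) []
        (List.replicate i true) (List.replicate (n - (i + 1)) true) out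
        (true :: List.replicate (n - (i + 1)) false))
      (false, sourceState W (List.replicate n true) [] (List.replicate i true)
        (List.replicate (n - (i + 1)) true) out (oneHot n i)) (7 * n + 3) := fun a =>
    Runs.conseq (by simp [sourceState, oneHot]) (by omega) (fill_src_runs (sourceState W
      (List.replicate n true) [] [] (List.replicate (n - (i + 1)) true) out
      (true :: List.replicate (n - (i + 1)) false)) i a)
  have h3 : ∀ a, Runs (.loop .num Option.isSome (block [.push .num2 fun _ => true, pass]))
      ((a, false), sourceState W (List.replicate n true) [] (List.replicate i true)
        (true :: List.replicate (n - (i + 1)) true) out (oneHot n i))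
      (false, sourceState W [] (List.replicate n true) (List.replicate i true)
        (true :: List.replicate (n - (i + 1)) true) out (reachRow W n i))
      (n * (W.length * (33 * n + 37) + 6) + 1) := by
    intro a
    have := Runs.loop_iterate (p := Option.isSome) (k := .num) (w := false)
      (c := block [.push .num2 fun _ => true, pass]) (b := W.length * (33 * n + 37) + 5)
      (fun j => sourceState W (List.replicate j true) (List.replicate (n - j) true)
        (List.replicate i true) (true :: List.replicate (n - (i + 1)) true) out
        ((fun R => W.foldl edgeStep R)^[n - j] (oneHot n i))) n
      (fun _ _ => rfl) (fun j hj => ?_) rfl a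
    · rw [Nat.sub_self] at this
      exact this
    · rw [show n - j = n - (j + 1) + 1 by omega, Function.iterate_succ_apply']
      refine Runs.mono (.push (.cons (pass_runs (sourceState W (List.replicate j true)
        (true :: List.replicate (n - (j + 1)) true) (List.replicate i true)
        (true :: List.replicate (n - (i + 1)) true) out []) W hW ?_ _) fun a => .nil)) (by omega)
      exact (length_iterate_foldl_edgeStep W _ _).trans (length_oneHot hi)
  have h4 : ∀ a, Runs (block [moveAll .num2 .num, moveAll .row .aux, moveAll .aux .out])
      ((a, false), sourceState W [] (List.replicate n true) (List.replicate i true)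
        (true :: List.replicate (n - (i + 1)) true) out (reachRow W n i))
      (false, sourceState W (List.replicate n true) []
        (List.replicate i true) (List.replicate (n - i) true) (reachRow W n i ++ out) [])
      (9 * n + 4) := by
    intro a
    have hlen : (reachRow W n i).length = n := by
      rw [reachRow, length_iterate_foldl_edgeStep, length_oneHot hi]
    refine Runs.conseq ?_ ?_ (.cons (moveAll_runs (by decide) a) fun a =>
      .cons (moveAll_runs (by decide) a) fun a => .cons (moveAll_runs (by decide) a) fun a => .nil)
    · rw [show n - i = n - (i + 1) + 1 by omega]
      simp [sourceState, Stacks.set, Stacks.get, List.replicate_succ]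
    · simp [sourceState, Stacks.set, Stacks.get, hlen]
      omega
  exact Runs.mono (.cons (h1 a) fun a => .push (.cons (h2 a) fun a => .push
    (.cons (h3 a) fun a => h4 a))) (by omega)

end Source

/-! ### Discarding the edges whose duals are marked. -/

section Filter

variable {rest D : List Bool} {n : ℕ}

/-- The ends of the edges that are not marked. -/
def unmarkedEnds (l : List (Bool × EdgeCode)) : List (ℕ × ℕ) :=
  l.filterMap fun p => if p.1 then none else some (p.2.1, p.2.2.2.1)

/-- Translate the code of an edge on `dart2` to the bit string that `pass` processes. -/
def emit : Cmd Stack :=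
  block [.push .dart fun _ => true,
    .loop .dart2 (fun b => b == some true)
      (block [.push .dart fun _ => true, .push .aux fun _ => true]),
    .push .dart fun _ => false, skipField .dart2, moveField .dart2 .dart, skipField .dart2,
    moveAll .aux .dart, .push .dart fun _ => false]

/-- Keep the next edge if it is not marked. -/
def filterStep : Cmd Stack :=
  block [.load fun v => (none, v.1.getD false), .ite (fun v => v.2)
    (block [skipField .dart2, skipField .dart2, skipField .dart2, skipField .dart2]) emit,
    .load fun _ => (none, false)]

/-- The stacks while the marked edges are removed. -/
def filterState (n : ℕ) (inp dart dart2 aux : List Bool) : Stacks where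
  inp := inp
  num := List.replicate n true
  src := List.replicate n true
  dart := dart
  dart2 := dart2
  aux := aux

/-- `pass` visits the first end again after the second one, so a copy of the first number is kept on
`aux`. -/
theorem emit_runs (e : EdgeCode) (inp : List Bool) (a : Option Bool) :
    Runs emit ((a, false), filterState n inp D (encodeEdge e ++ rest) [])
      (false, filterState n inp ((encodeEnds (e.1, e.2.2.1)).reverse ++ D) rest [])
      (7 * e.1 + 2 * e.2.1 + 3 * e.2.2.1 + 2 * e.2.2.2 + 11) := by
  obtain ⟨t, x, u, y⟩ := e
  have henc : encodeEdge (t, x, u, y) ++ rest =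
      unary t ++ (unary x ++ (unary u ++ (unary y ++ rest))) := by
    simp [encodeEdge]
  rw [henc]
  have h1 : ∀ a, Runs (.loop .dart2 (fun b => b == some true)
      (block [.push .dart fun _ => true, .push .aux fun _ => true]))
      ((a, false), filterState n inp (true :: D)
        (unary t ++ (unary x ++ (unary u ++ (unary y ++ rest)))) [])
      (false, filterState n inp (List.replicate t true ++ true :: D)
        (unary x ++ (unary u ++ (unary y ++ rest))) (List.replicate t true)) (4 * t + 1) := by
    intro a
    have := Runs.loop_iterate (p := fun b => b == some true) (k := .dart2) (w := false)
      (c := block [.push .dart fun _ => true, .push .aux fun _ => true]) (b := 3)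
      (fun i => filterState n inp (List.replicate (t - i) true ++ true :: D)
        (unary i ++ (unary x ++ (unary u ++ (unary y ++ rest)))) (List.replicate (t - i) true)) t
      (fun _ _ => rfl) (fun i hi => ?_) rfl a
    · rw [Nat.sub_self, mul_comm] at this
      exact this
    · rw [show t - i = t - (i + 1) + 1 by omega]
      exact (Runs.push (.push .nil)).congr rfl
  have h2 : ∀ a, Runs (block [moveField .dart2 .dart, skipField .dart2,
      moveAll .aux .dart, .push .dart fun _ => false])
      ((a, false), filterState n inp ((unary t).reverse ++ true :: D)
        (unary u ++ (unary y ++ rest)) (List.replicate t true))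
      (false, filterState n inp ((encodeEnds (t, u)).reverse ++ D) rest [])
      (3 * u + 2 * y + 3 * t + 7) := by
    intro a
    refine Runs.conseq ?_ ?_ (.cons (moveField_runs (by decide) rfl a) fun a =>
      .cons (skipField_runs rfl a) fun a => .cons (moveAll_runs (by decide) a) fun a =>
      .push .nil)
    · simp [filterState, Stacks.set, Stacks.get, encodeEnds, reverse_unary]
    · simp [filterState, Stacks.set, Stacks.get]
      omega
  rw [reverse_unary] at h2
  exact Runs.mono (.push (.cons (h1 _) fun a => .push (.cons (skipField_runs rfl _) fun a =>
    h2 a))) (by dsimp only; omega)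

theorem filterStep_runs (j : Bool) (e : EdgeCode) (inp : List Bool) (w : Bool) :
    Runs filterStep ((some j, w), filterState n inp D (encodeEdge e ++ rest) [])
      (false, filterState n inp (if j then D else (encodeEnds (e.1, e.2.2.1)).reverse ++ D) rest [])
      (7 * e.1 + 2 * e.2.1 + 3 * e.2.2.1 + 2 * e.2.2.2 + 15) := by
  have h : Runs (.ite (fun v => v.2)
      (block [skipField .dart2, skipField .dart2, skipField .dart2, skipField .dart2]) emit)
      ((none, j), filterState n inp D (encodeEdge e ++ rest) [])
      (j, filterState n inp (if j then D else (encodeEnds (e.1, e.2.2.1)).reverse ++ D) rest [])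
      (1 + (7 * e.1 + 2 * e.2.1 + 3 * e.2.2.1 + 2 * e.2.2.2 + 11)) := by
    refine Runs.ite ?_
    cases j
    · exact emit_runs e inp none
    · have henc : encodeEdge e ++ rest =
          unary e.1 ++ (unary e.2.1 ++ (unary e.2.2.1 ++ (unary e.2.2.2 ++ rest))) := by
        simp [encodeEdge]
      rw [henc]
      exact Runs.mono (.cons (skipField_runs rfl _) fun a => .cons (skipField_runs rfl a) fun a =>
        .cons (skipField_runs rfl a) fun a => .cons (skipField_runs rfl a) fun a => .nil)
        (by omega)
  exact Runs.mono (.load (.cons h fun a => .load .nil)) (by omega)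

theorem filter_runs (l : List (Bool × EdgeCode)) (B : ℕ)
    (hB : ∀ p ∈ l, 7 * p.2.1 + 2 * p.2.2.1 + 3 * p.2.2.2.1 + 2 * p.2.2.2.2 + 15 ≤ B)
    (a : Option Bool) :
    Runs (.loop .inp Option.isSome filterStep)
      ((a, false), filterState n (l.map Prod.fst) [] ((l.map Prod.snd).flatMap encodeEdge) [])
      (false, filterState n [] ((unmarkedEnds l).flatMap encodeEnds).reverse [] [])
      (l.length * (B + 1) + 1) := by
  have key := Runs.loop_foldl (p := Option.isSome) (k := .inp) (c := filterStep) (w := false)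
    (b := B)
    (fun r D => filterState n (r.map Prod.fst) D ((r.map Prod.snd).flatMap encodeEdge) [])
    (fun D p => if p.1 then D else (encodeEnds (p.2.1, p.2.2.2.1)).reverse ++ D) (fun _ => True)
    l [] trivial (by simp) (by intros; rfl) (fun p hp r D _ => ?_) (by intros; rfl) a
  · have hfold : ∀ (l : List (Bool × EdgeCode)) (D : List Bool),
        l.foldl (fun D p => if p.1 then D else (encodeEnds (p.2.1, p.2.2.2.1)).reverse ++ D) D =
          ((unmarkedEnds l).flatMap encodeEnds).reverse ++ D := by
      intro l
      induction l with
      | nil => simp [unmarkedEnds]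
      | cons p l ih =>
        intro D
        rw [List.foldl_cons, ih]
        obtain ⟨j, e⟩ := p
        cases j <;> simp [unmarkedEnds]
    rw [hfold, List.append_nil] at key
    exact key
  · refine (filterStep_runs p.1 p.2 _ _).mono (hB p hp)

end Filter

/-! ### The program for `comp ∘ D⁻¹`. -/

section Program

/-- The program that computes `comp ∘ D⁻¹`. -/
def compDualProgram : Cmd Stack :=
  block [readGraph, clear .cnt2,
    .loop .num Option.isSome (block [.push .num2 fun _ => true, .push .src fun _ => true]),
    moveAll .num2 .num, .loop .inp Option.isSome filterStep, moveAll .dart .dart2,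
    .loop .src Option.isSome sourceStep, clear .num, clear .dart2, clear .pre]

/-- The dominant cost, of fourth order, comes from n rows, n passes per row, at most `l.length`
edges per pass, and time linear in n per edge. -/
theorem compDualProgram_runs (n : ℕ) (l : List (Bool × EdgeCode))
    (hl : ∀ p ∈ l, p.2.1 < n ∧ p.2.2.2.1 < n) (a : Option Bool) (L : ℕ)
    (hL : n + l.length + ((l.map Prod.snd).flatMap encodeEdge).length ≤ L) :
    Runs compDualProgram
      ((a, false), { inp := unary n ++ (unary (l.map Prod.snd).length ++
        ((l.map Prod.snd).flatMap encodeEdge ++ l.map Prod.fst)) })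
      (false, { out := (List.range n).flatMap (reachRow (unmarkedEnds l) n) })
      (300 * (L + 1) ^ 4) := by
  set W := unmarkedEnds l with hWdef
  have hW : ∀ e ∈ W, e.1 < n ∧ e.2 < n := by
    intro e he
    obtain ⟨p, hp, h⟩ := List.mem_filterMap.1 he
    split_ifs at h
    cases h
    exact hl p hp
  have hWl : W.length ≤ l.length := List.length_filterMap_le _ _
  have h1 : ∀ a, Runs (.loop .num Option.isSome
      (block [.push .num2 fun _ => true, .push .src fun _ => true]))
      ((a, false), {
        inp := l.map Prod.fst
        num := List.replicate n true
        dart2 := (l.map Prod.snd).flatMap encodeEdge })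
      (false, {
        inp := l.map Prod.fst
        num2 := List.replicate n true
        src := List.replicate n true
        dart2 := (l.map Prod.snd).flatMap encodeEdge }) (4 * n + 1) := by
    intro a
    have := Runs.loop_iterate (p := Option.isSome) (k := .num) (w := false)
      (c := block [.push .num2 fun _ => true, .push .src fun _ => true]) (b := 3)
      (fun i => {
        inp := l.map Prod.fst
        num := List.replicate i true
        num2 := List.replicate (n - i) true
        src := List.replicate (n - i) true
        dart2 := (l.map Prod.snd).flatMap encodeEdge }) n
      (fun _ _ => rfl) (fun i hi => ?_) rfl a
    · rw [Nat.sub_self, mul_comm] at this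
      exact this
    · rw [show n - i = n - (i + 1) + 1 by omega]
      exact (Runs.push (.push .nil)).congr rfl
  have h2 : ∀ a, Runs (moveAll .num2 .num)
      ((a, false), {
        inp := l.map Prod.fst
        num2 := List.replicate n true
        src := List.replicate n true
        dart2 := (l.map Prod.snd).flatMap encodeEdge })
      (false, filterState n (l.map Prod.fst) [] ((l.map Prod.snd).flatMap encodeEdge) [])
      (3 * n + 1) := fun a =>
    Runs.conseq (by simp [filterState, Stacks.set, Stacks.get]) (by simp [Stacks.get])
      (moveAll_runs (by decide) a)
  have h3 : ∀ a, Runs (.loop .inp Option.isSome filterStep)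
      ((a, false), filterState n (l.map Prod.fst) [] ((l.map Prod.snd).flatMap encodeEdge) [])
      (false, filterState n [] (W.flatMap encodeEnds).reverse [] []) (l.length * (7 * L + 16) + 1) := by
    refine fun a => filter_runs l (7 * L + 15) (fun p hp => ?_) a
    have := length_encodeEdge_le (List.mem_map_of_mem (f := Prod.snd) hp)
    omega
  have hWL := length_flatMap_encodeEnds_le W hW
  have h4 : ∀ a, Runs (moveAll .dart .dart2)
      ((a, false), filterState n [] (W.flatMap encodeEnds).reverse [] [])
      (false, sourceState W (List.replicate n true) [] (List.replicate n true) [] [] [])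
      (3 * (W.length * (3 * n + 4)) + 1) := fun a =>
    Runs.conseq (by simp [filterState, sourceState, Stacks.set, Stacks.get])
      (by simp only [filterState, Stacks.get, List.length_reverse]; omega)
      (moveAll_runs (by decide) a)
  have h5 : ∀ a, Runs (.loop .src Option.isSome sourceStep)
      ((a, false), sourceState W (List.replicate n true) [] (List.replicate n true) [] [] [])
      (false, sourceState W (List.replicate n true) [] [] (List.replicate n true)
        ((List.range n).flatMap (reachRow W n)) [])
      (n * (n * (W.length * (33 * n + 37) + 6) + 23 * n + 13 + 1) + 1) := by
    intro a
    have := Runs.loop_iterate (p := Option.isSome) (k := .src) (c := sourceStep) (w := false)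
      (b := n * (W.length * (33 * n + 37) + 6) + 23 * n + 13)
      -- When `i` iterations remain, the rows with indices `i, …, n - 1` are already on `out`.
      (fun i => sourceState W (List.replicate n true) [] (List.replicate i true)
        (List.replicate (n - i) true) (((List.range n).drop i).flatMap (reachRow W n)) []) n
      (fun _ _ => rfl) (fun i hi => ?_) rfl a
    · rw [Nat.sub_self, List.drop_eq_nil_of_le (by simp)] at this
      exact this
    · rw [List.drop_eq_getElem_cons (i := i) (by simpa using hi), List.getElem_range,
        List.flatMap_cons]
      exact sourceStep_runs W hW hi _ _
  have h6 : ∀ a, Runs (block [clear .num, clear .dart2, clear .pre])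
      ((a, false), sourceState W (List.replicate n true) [] [] (List.replicate n true)
        ((List.range n).flatMap (reachRow W n)) [])
      (false, { out := (List.range n).flatMap (reachRow W n) })
      (4 * n + 2 * (W.length * (3 * n + 4)) + 4) := by
    refine fun a => Runs.conseq rfl ?_ (.cons (clear_runs a) fun a => .cons (clear_runs a) fun a =>
      .cons (clear_runs a) fun a => .nil)
    simp only [sourceState, Stacks.set, Stacks.get, List.length_replicate]
    omega
  refine Runs.mono (.cons (readGraph_runs n (l.map Prod.snd) (l.map Prod.fst) a) fun a =>
    .cons (clear_runs a) fun a => .cons (h1 a) fun a => .cons (h2 a) fun a => .cons (h3 a) fun a =>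
    .cons (h4 a) fun a => .cons (h5 a) h6) ?_
  simp only [Stacks.get, List.length_replicate, List.length_map]
  have hn : n ≤ L := by omega
  have hm : l.length ≤ L := by omega
  have hw : W.length ≤ L := by omega
  have hf : ((l.map Prod.snd).flatMap encodeEdge).length ≤ L := by omega
  have e1 : l.length * (3 * ((l.map Prod.snd).flatMap encodeEdge).length + 3) ≤ L * (3 * L + 3) := by
    gcongr
  have e2 : l.length * (7 * L + 16) ≤ L * (7 * L + 16) := by gcongr
  have e3 : W.length * (3 * n + 4) ≤ L * (3 * L + 4) := by gcongr
  have e4 : n * (n * (W.length * (33 * n + 37) + 6) + 23 * n + 13 + 1) ≤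
      L * (L * (L * (33 * L + 37) + 6) + 23 * L + 13 + 1) := by gcongr
  -- Expanding everything into the monomials of `L`, taken as atoms, leaves a linear inequality.
  have e5 : 300 * (L + 1) ^ 4 = 300 * (L * L * L * L) + 1200 * (L * L * L) + 1800 * (L * L) +
      1200 * L + 300 := by ring
  have e6 : L * (3 * L + 3) = 3 * (L * L) + 3 * L := by ring
  have e7 : L * (7 * L + 16) = 7 * (L * L) + 16 * L := by ring
  have e8 : L * (3 * L + 4) = 3 * (L * L) + 4 * L := by ring
  have e9 : L * (L * (L * (33 * L + 37) + 6) + 23 * L + 13 + 1) = 33 * (L * L * L * L) +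
      37 * (L * L * L) + 29 * (L * L) + 14 * L := by ring
  omega

end Program

end StackProgram

namespace StackProgram

/-! ### Relaxation computes the reachability relation. -/

section Reachability

variable {n : ℕ} {W : List (ℕ × ℕ)} {R R' : List Bool}

/-- `w` is joined to `v` by a pair in `W`. -/
def Joined (W : List (ℕ × ℕ)) (v w : ℕ) : Prop :=
  (v, w) ∈ W ∨ (w, v) ∈ W

/-- The indices of the entries `true`. -/
def support (R : List Bool) : Finset ℕ :=
  {w ∈ Finset.range R.length | R.getD w false = true}

theorem mem_support {w : ℕ} : w ∈ support R ↔ R.getD w false = true := by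
  simp only [support, Finset.mem_filter, Finset.mem_range, and_iff_right_iff_imp]
  intro h
  by_contra hw
  rw [List.getD_eq_default _ _ (not_lt.1 hw)] at h
  exact absurd h (by decide)

theorem eq_of_support_eq (hl : R.length = R'.length) (h : support R = support R') : R = R' := by
  refine List.ext_getElem hl fun i h₁ h₂ => ?_
  have := Finset.ext_iff.1 h i
  rw [mem_support, mem_support, List.getD_eq_getElem _ _ h₁, List.getD_eq_getElem _ _ h₂] at this
  exact Bool.eq_iff_iff.2 this

/-- The visits to `a`, `b` and `a` again carry the disjunction forward to `b` and back to `a`, so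
both entries end up with it. -/
theorem getD_edgeStep {a b : ℕ} (ha : a < R.length) (hb : b < R.length) (w : ℕ) :
    (edgeStep R (a, b)).getD w false =
      (R.getD w false || ((w = a || w = b) && (R.getD a false || R.getD b false))) := by
  have key : ∀ (R : List Bool) (i : ℕ) (x : Bool), i < R.length → ∀ w,
      (R.set i x).getD w false = if w = i then x else R.getD w false := by
    intro R i x hi w
    simp only [List.getD_eq_getElem?_getD, List.getElem?_set]
    by_cases h : w = i
    · subst h
      simp [hi]
    · simp [h, Ne.symm h]
  simp only [edgeStep, key, List.length_set, ha, hb]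
  by_cases h₁ : w = a <;> by_cases h₂ : w = b <;> by_cases h₃ : b = a <;>
    cases hA : R.getD a false <;> cases hB : R.getD b false <;> simp_all

theorem support_subset_edgeStep {e : ℕ × ℕ} (he : e.1 < R.length ∧ e.2 < R.length) :
    support R ⊆ support (edgeStep R e) := by
  intro w hw
  rw [mem_support] at hw ⊢
  rw [getD_edgeStep he.1 he.2, hw, Bool.true_or]

theorem support_subset_foldl (hW : ∀ e ∈ W, e.1 < R.length ∧ e.2 < R.length) :
    support R ⊆ support (W.foldl edgeStep R) := by
  induction W generalizing R with
  | nil => exact subset_rfl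
  | cons e W ih =>
    refine (support_subset_edgeStep (hW e List.mem_cons_self)).trans (ih fun e' he' => ?_)
    rw [length_edgeStep]
    exact hW e' (List.mem_cons_of_mem _ he')

/-- Supports only grow, so if a whole pass changes nothing then no single step does. -/
theorem edgeStep_eq_of_foldl_eq (hW : ∀ e ∈ W, e.1 < R.length ∧ e.2 < R.length)
    (h : W.foldl edgeStep R = R) : ∀ e ∈ W, edgeStep R e = R := by
  induction W with
  | nil => simp
  | cons e W ih =>
    have hW' : ∀ e' ∈ W, e'.1 < R.length ∧ e'.2 < R.length := fun e' he' =>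
      hW e' (List.mem_cons_of_mem _ he')
    rw [List.foldl_cons] at h
    have he : edgeStep R e = R := by
      refine eq_of_support_eq (length_edgeStep R e) (Finset.Subset.antisymm ?_
        (support_subset_edgeStep (hW e List.mem_cons_self)))
      have := support_subset_foldl (R := edgeStep R e) (W := W) (by rwa [length_edgeStep])
      rwa [h] at this
    rw [he] at h
    intro e' he'
    obtain rfl | he' := List.mem_cons.1 he'
    · exact he
    · exact ih hW' h e' he'

theorem mem_support_of_joined (hW : ∀ e ∈ W, e.1 < R.length ∧ e.2 < R.length)
    (h : W.foldl edgeStep R = R) {v w : ℕ} (hvw : Joined W v w) (hv : v ∈ support R) :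
    w ∈ support R := by
  rw [mem_support] at hv
  obtain hvw | hvw := hvw
  · rw [← edgeStep_eq_of_foldl_eq hW h _ hvw, mem_support, getD_edgeStep (hW _ hvw).1 (hW _ hvw).2, hv]
    simp
  · rw [← edgeStep_eq_of_foldl_eq hW h _ hvw, mem_support, getD_edgeStep (hW _ hvw).1 (hW _ hvw).2, hv]
    simp

theorem foldl_edgeStep_induction {p : ℕ → Prop} (hp : ∀ v w, Joined W v w → p v → p w)
    (hW : ∀ e ∈ W, e.1 < R.length ∧ e.2 < R.length) (hR : ∀ w ∈ support R, p w) :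
    ∀ w ∈ support (W.foldl edgeStep R), p w := by
  -- The relation `Joined W` has to stay fixed while the list being folded shrinks.
  suffices ∀ W', W' ⊆ W → ∀ w ∈ support (W'.foldl edgeStep R), p w from this W (List.Subset.refl _)
  intro W'
  induction W' generalizing R with
  | nil => exact fun _ => hR
  | cons e W' ih =>
    intro hs
    have he := hs List.mem_cons_self
    refine ih (fun e' he' => by rw [length_edgeStep]; exact hW e' he') (fun w hw => ?_)
      (fun e' he' => hs (List.mem_cons_of_mem _ he'))
    rw [mem_support, getD_edgeStep (hW e he).1 (hW e he).2, Bool.or_eq_true, Bool.and_eq_true,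
      Bool.or_eq_true, Bool.or_eq_true, decide_eq_true_iff, decide_eq_true_iff, ← mem_support,
      ← mem_support, ← mem_support] at hw
    obtain hw | ⟨rfl | rfl, h | h⟩ := hw
    · exact hR w hw
    · exact hR _ h
    · exact hp _ _ (.inr he) (hR _ h)
    · exact hp _ _ (.inl he) (hR _ h)
    · exact hR _ h

theorem support_oneHot {i : ℕ} (hi : i < n) : support (oneHot n i) = {i} := by
  ext w
  rw [mem_support, oneHot, Finset.mem_singleton, List.getD_eq_getElem?_getD]
  obtain h | rfl | h := lt_trichotomy w i
  · rw [List.getElem?_append_left (by simpa using h)]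
    simp [h, h.ne]
  · rw [List.getElem?_append_right (by simp)]
    simp
  · rw [List.getElem?_append_right (by simpa using h.le)]
    obtain ⟨j, rfl⟩ := Nat.exists_eq_add_of_lt h
    rw [List.length_replicate, show i + j + 1 - i = j + 1 by omega, List.getElem?_cons_succ,
      List.getElem?_replicate]
    split <;> simp <;> omega

/-- The support starts with one element and grows in each pass until the row is stable. After `j`
passes the row is stable or has at least `j + 1` true entries, and the latter is impossible for `j =
n`. -/
theorem foldl_reachRow (hW : ∀ e ∈ W, e.1 < n ∧ e.2 < n) {i : ℕ} (hi : i < n) :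
    W.foldl edgeStep (reachRow W n i) = reachRow W n i := by
  have hlen : ∀ j, ((fun R => W.foldl edgeStep R)^[j] (oneHot n i)).length = n := fun j =>
    (length_iterate_foldl_edgeStep W _ _).trans (length_oneHot hi)
  have key : ∀ j, (W.foldl edgeStep ((fun R => W.foldl edgeStep R)^[j] (oneHot n i)) =
        (fun R => W.foldl edgeStep R)^[j] (oneHot n i)) ∨
      j + 1 ≤ (support ((fun R => W.foldl edgeStep R)^[j] (oneHot n i))).card := by
    intro j
    induction j with
    | zero =>
      right
      rw [Function.iterate_zero_apply, support_oneHot hi, Finset.card_singleton]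
    | succ j ih =>
      rw [Function.iterate_succ_apply']
      obtain h | h := ih
      · left
        rw [h, h]
      · by_cases h' : W.foldl edgeStep ((fun R => W.foldl edgeStep R)^[j] (oneHot n i)) =
          (fun R => W.foldl edgeStep R)^[j] (oneHot n i)
        · left
          rw [h', h']
        · right
          refine Nat.succ_le_of_lt (h.trans_lt (Finset.card_lt_card ?_))
          refine (support_subset_foldl (by rwa [hlen])).ssubset_of_ne fun hs => h' ?_
          exact (eq_of_support_eq (length_foldl_edgeStep _ _).symm hs).symm
  refine (key n).resolve_right fun h => ?_
  have : (support ((fun R => W.foldl edgeStep R)^[n] (oneHot n i))).card ≤ n :=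
    (Finset.card_filter_le _ _).trans_eq ((Finset.card_range _).trans (hlen n))
  exact absurd (Nat.le_trans h this) (Nat.not_succ_le_self n)

/-- Each pass adds only reachable indices; conversely, the final row is stable, hence closed under
`Joined`, and contains `v`. -/
theorem getD_reachRow_iff (hW : ∀ e ∈ W, e.1 < n ∧ e.2 < n) {v : ℕ} (hv : v < n) (w : ℕ) :
    (reachRow W n v).getD w false = true ↔ Relation.ReflTransGen (Joined W) v w := by
  have hlen : ∀ j, ((fun R => W.foldl edgeStep R)^[j] (oneHot n v)).length = n := fun j =>
    (length_iterate_foldl_edgeStep W _ _).trans (length_oneHot hv)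
  have hlen' : (reachRow W n v).length = n := hlen n
  rw [← mem_support]
  constructor
  · suffices ∀ j, ∀ w ∈ support ((fun R => W.foldl edgeStep R)^[j] (oneHot n v)),
        Relation.ReflTransGen (Joined W) v w from this n w
    intro j
    induction j with
    | zero =>
      intro w hw
      rw [Function.iterate_zero_apply, support_oneHot hv, Finset.mem_singleton] at hw
      rw [hw]
    | succ j ih =>
      rw [Function.iterate_succ_apply']
      exact foldl_edgeStep_induction (fun _ _ h h' => h'.tail h) (by rwa [hlen]) ih
  · intro h
    induction h with
    | refl =>
      suffices ∀ j, v ∈ support ((fun R => W.foldl edgeStep R)^[j] (oneHot n v)) from this n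
      intro j
      induction j with
      | zero => rw [Function.iterate_zero_apply, support_oneHot hv, Finset.mem_singleton]
      | succ j ih =>
        rw [Function.iterate_succ_apply']
        exact support_subset_foldl (by rwa [hlen]) ih
    | tail _ h ih =>
      exact mem_support_of_joined (by rwa [hlen']) (foldl_reachRow hW hv) h ih

end Reachability

end StackProgram

/-! ### Correctness of the program for `comp ∘ D⁻¹` on encoded inputs. -/

section Encoding

variable {n m : ℕ}

theorem mem_comp_iff {V E : Type*} (M : RotationSystem V E) (J : Set E) (v w : V) :
    (∃ A ∈ comp M.graph J, v ∈ A ∧ w ∈ A) ↔ Reachable (M.graph.restrict Jᶜ) v w := by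
  rw [comp_eq_componentSets M.graph rfl]
  constructor
  · rintro ⟨A, ⟨u, -, rfl⟩, hv, hw⟩
    exact Reachable.trans (Reachable.symm hv) hw
  · exact fun h => ⟨_, ⟨v, Set.mem_univ v, rfl⟩, .refl _ v, h⟩

theorem mem_unmarkedEnds_iff (M : RotationSystem (Fin n) (Fin m)) (J : Set (DualEdge (Fin m)))
    (p : ℕ × ℕ) :
    p ∈ StackProgram.unmarkedEnds ((encodeDualEdgeSet J).zip (edgeCodes M)) ↔
      ∃ e, DualEdge.mk e ∉ J ∧ ((M.tail (e, false) : ℕ), (M.tail (e, true) : ℕ)) = p := by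
  rw [encodeDualEdgeSet, edgeCodes, List.zip_map']
  simp only [StackProgram.unmarkedEnds, List.mem_filterMap, List.mem_map, List.mem_finRange,
    true_and, exists_exists_eq_and]
  refine exists_congr fun e => ?_
  by_cases h : DualEdge.mk e ∈ J <;> simp [h]

theorem joined_iff_adj (M : RotationSystem (Fin n) (Fin m)) (J : Set (DualEdge (Fin m)))
    (v w : Fin n) :
    StackProgram.Joined
        (StackProgram.unmarkedEnds ((encodeDualEdgeSet J).zip (edgeCodes M))) v w ↔
      (M.graph.restrict ((dualEdges _).symm J)ᶜ).Adj v w := by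
  rw [StackProgram.Joined, mem_unmarkedEnds_iff, mem_unmarkedEnds_iff]
  simp only [Prod.mk.injEq, ← Fin.ext_iff]
  constructor
  · rintro (⟨e, he, h₁, h₂⟩ | ⟨e, he, h₁, h₂⟩)
    · exact ⟨e, he, false, h₁, h₂⟩
    · exact ⟨e, he, true, h₂, h₁⟩
  · rintro ⟨e, he, _ | _, h₁, h₂⟩
    · exact .inl ⟨e, he, h₁, h₂⟩
    · exact .inr ⟨e, he, h₂, h₁⟩

theorem reflTransGen_joined_iff (M : RotationSystem (Fin n) (Fin m)) (J : Set (DualEdge (Fin m)))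
    (v w : Fin n) :
    Relation.ReflTransGen (StackProgram.Joined
        (StackProgram.unmarkedEnds ((encodeDualEdgeSet J).zip (edgeCodes M)))) v w ↔
      Reachable (M.graph.restrict ((dualEdges _).symm J)ᶜ) v w := by
  constructor
  · suffices ∀ w', Relation.ReflTransGen (StackProgram.Joined
        (StackProgram.unmarkedEnds ((encodeDualEdgeSet J).zip (edgeCodes M)))) v w' →
        ∃ w : Fin n, w = w' ∧ Reachable (M.graph.restrict ((dualEdges _).symm J)ᶜ) v w by
      intro h
      obtain ⟨w', hw, h⟩ := this _ h
      rwa [← Fin.ext hw]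
    intro w' h
    induction h with
    | refl => exact ⟨v, rfl, .refl _ _⟩
    | @tail _ y _ h ih =>
      obtain ⟨x, rfl, hx⟩ := ih
      -- `Joined` is a relation on `ℕ`, but both ends of a listed pair come from vertices, so the
      -- walk never leaves `Fin n`.
      have hy : y < n := by
        obtain h | h := h <;> obtain ⟨e, -, he⟩ := (mem_unmarkedEnds_iff M J _).1 h
        · exact (Prod.mk.inj he).2 ▸ Fin.is_lt _
        · exact (Prod.mk.inj he).1 ▸ Fin.is_lt _
      exact ⟨⟨y, hy⟩, rfl, hx.tail ((joined_iff_adj M J x ⟨y, hy⟩).1 h)⟩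
  · intro h
    exact h.lift _ fun x y hxy => (joined_iff_adj M J x y).2 hxy

theorem encodePartition_compDual (M : RotationSystem (Fin n) (Fin m))
    (J : Set (DualEdge (Fin m))) :
    encodePartition (M.compDual J) = (List.range n).flatMap (StackProgram.reachRow
      (StackProgram.unmarkedEnds ((encodeDualEdgeSet J).zip (edgeCodes M))) n) := by
  classical
  have hW : ∀ p ∈ StackProgram.unmarkedEnds ((encodeDualEdgeSet J).zip (edgeCodes M)),
      p.1 < n ∧ p.2 < n := by
    intro p hp
    obtain ⟨e, -, rfl⟩ := (mem_unmarkedEnds_iff M J p).1 hp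
    exact ⟨Fin.is_lt _, Fin.is_lt _⟩
  rw [← List.map_coe_finRange_eq_range, List.flatMap_map, encodePartition]
  congr 1
  funext v
  have hlen : (StackProgram.reachRow (StackProgram.unmarkedEnds
      ((encodeDualEdgeSet J).zip (edgeCodes M))) n v).length = n :=
    (StackProgram.length_iterate_foldl_edgeStep _ _ _).trans (StackProgram.length_oneHot v.2)
  refine List.ext_getElem (by simp [encodeVertexSet, hlen]) fun w h₁ h₂ => ?_
  have hw : w < n := hlen ▸ h₂
  rw [← List.getD_eq_getElem _ false h₂, Bool.eq_iff_iff,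
    StackProgram.getD_reachRow_iff hW v.2 w,
    reflTransGen_joined_iff M J v ⟨w, hw⟩, ← mem_comp_iff]
  simp [encodeVertexSet, RotationSystem.compDual]

theorem computableInPolyTime_compDual :
    Nonempty (Turing.TM2ComputableInPolyTime DualPartitionInstance.encode
      (fun P : Σ n : ℕ, Set (Set (Fin n)) => encodePartition P.2)
      DualPartitionInstance.compDual) := by
  refine StackProgram.nonempty_computableInPolyTime_of_runs _ _ _ StackProgram.compDualProgram
    (Polynomial.C 300 * (Polynomial.X + 1) ^ 4) fun I => ?_
  obtain ⟨n, m, k, M, hM, J, hJ⟩ := I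
  have hl : (encodeDualEdgeSet J).length = (edgeCodes M).length := by
    simp [encodeDualEdgeSet, edgeCodes]
  have henc := encodePlaneGraph_append M (encodeDualEdgeSet J)
  have := StackProgram.compDualProgram_runs n ((encodeDualEdgeSet J).zip (edgeCodes M))
    (fun p hp => ?_) none (encodePlaneGraph M ++ encodeDualEdgeSet J).length ?_
  · simp only [DualPartitionInstance.encode, Polynomial.eval_mul, Polynomial.eval_C,
      Polynomial.eval_pow, Polynomial.eval_add, Polynomial.eval_X, Polynomial.eval_one]
    rw [List.map_fst_zip hl.le, List.map_snd_zip hl.ge, ← henc,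
      ← encodePartition_compDual] at this
    exact this
  · have := (List.of_mem_zip hp).2
    simp only [edgeCodes, List.mem_map] at this
    obtain ⟨e, -, he⟩ := this
    rw [← he]
    exact ⟨Fin.is_lt _, Fin.is_lt _⟩
  · rw [henc, List.map_snd_zip hl.ge, List.length_zip]
    simp only [List.length_append, StackProgram.length_unary]
    omega

end Encoding

end PlaneDuality

theorem mainTheorem10 :
    (∀ (V E : Type*) [Finite V] [Finite E] (M : PlaneDuality.RotationSystem V E),
      M.IsConnectedPlane →
        (∀ k : ℕ,
          Set.BijOn M.dualCut
            (PlaneDuality.connectedPartitions M.graph k) (PlaneDuality.dualPartitions M.dual k) ∧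
          Set.BijOn M.compDual
            (PlaneDuality.dualPartitions M.dual k) (PlaneDuality.connectedPartitions M.graph k) ∧
          Set.InvOn M.compDual M.dualCut
            (PlaneDuality.connectedPartitions M.graph k) (PlaneDuality.dualPartitions M.dual k)) ∧
        (∀ (k : ℕ) (J : Set (PlaneDuality.DualEdge E)),
          J ∈ PlaneDuality.dualPartitions M.dual k ↔
            PlaneDuality.IsUnionOfCycles M.dual J ∧
              PlaneDuality.circuitRank (PlaneDuality.edgeInduce M.dual J) + 1 = k)) ∧
    Nonempty (Turing.TM2ComputableInPolyTime
      PlaneDuality.PartitionInstance.encode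
      (fun J : Σ m : ℕ, Set (PlaneDuality.DualEdge (Fin m)) =>
        PlaneDuality.encodeDualEdgeSet J.2)
      PlaneDuality.PartitionInstance.dualCut) ∧
    Nonempty (Turing.TM2ComputableInPolyTime
      PlaneDuality.DualPartitionInstance.encode
      (fun P : Σ n : ℕ, Set (Set (Fin n)) => PlaneDuality.encodePartition P.2)
      PlaneDuality.DualPartitionInstance.compDual) := by
  refine ⟨fun V E _ _ M hM => ⟨fun k => ⟨M.bijOn_dualCut hM, M.bijOn_compDual hM,
    M.invOn_compDual_dualCut hM⟩, fun k J => M.mem_dualPartitions_iff_isUnionOfCycles J⟩,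
    PlaneDuality.computableInPolyTime_dualCut, PlaneDuality.computableInPolyTime_compDual⟩
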